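/- For integers $\Delta,\ell,k\ge 1$, let $T_\ell$ be the complete rooted tree of depth $\ell$ in which every non-leaf vertex has exactly $\Delta$ children, let $L$ be its set of leaves (the vertices at depth $\ell$), and let $\mu_\ell$ be the uniform probability measure on the proper $k$-colorings of $T_\ell$, i.e. on the maps $\sigma:V(T_\ell)\to[k]=\{1,\dots,k\}$ with $\sigma(v)\ne\sigma(w)$ for every edge $\{v,w\}$ of $T_\ell$. Theorem. Let $C>1$ and $\varepsilon=\min\{C-1,1/3\}$. There are constants $\alpha=\alpha(\varepsilon)>0$, $\alpha'=\alpha'(\varepsilon)>0$, $\Delta_0=\Delta_0(\varepsilon)$ and $\ell_0=\ell_0(\varepsilon)$, depending only on $\varepsilon$, such that for all integers $\Delta>\Delta_0$, every integer $k>C\Delta/\ln\Delta$, every color $c\in[k]$ and every integer $\ell>\ell_0$, $$\Pr_{\tau\sim\mu_\ell}\Big[\,\big|\mu_\ell\big(\sigma(\mathrm{root})=c\,\big|\,\sigma(L)=\tau(L)\big)-1/k\big|>\Delta^{-\alpha\ell}\Big]\;\le\;e^{-\Delta^{\alpha'\ell}}.$$ -/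

import Mathlib

open MeasureTheory ProbabilityTheory

namespace TreeColoring

/-- Vertices of the complete tree `T_ℓ` of depth `ℓ` and branching factor `Δ`: a vertex is the list
of child indices read along the path from the root to it, so its depth is the length of the list. -/
abbrev Vertex (Δ ℓ : ℕ) : Type := {v : List (Fin Δ) // v.length ≤ ℓ}

instance (Δ ℓ : ℕ) : Finite (Vertex Δ ℓ) := (List.finite_length_le (Fin Δ) ℓ).to_subtype

/-- The root. -/
def root (Δ ℓ : ℕ) : Vertex Δ ℓ := ⟨[], Nat.zero_le ℓ⟩

/-- The set `L_ℓ` of leaves: the vertices at depth `ℓ`. -/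
def leaves (Δ ℓ : ℕ) : Set (Vertex Δ ℓ) := {v | v.1.length = ℓ}

/-- The vertex `w` is a child of the vertex `v`. -/
def IsChild {Δ ℓ : ℕ} (v w : Vertex Δ ℓ) : Prop := ∃ i : Fin Δ, w.1 = v.1 ++ [i]

/-- The complete tree `T_ℓ` with branching factor `Δ`, as a graph. -/
def completeTree (Δ ℓ : ℕ) : SimpleGraph (Vertex Δ ℓ) where
  Adj v w := IsChild v w ∨ IsChild w v
  symm := ⟨fun _ _ h => h.symm⟩
  loopless := ⟨fun v h => by
    rcases h with ⟨i, hi⟩ | ⟨i, hi⟩ <;> simpa using congrArg List.length hi⟩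

/-- The proper `k`-colorings of `T_ℓ`. -/
abbrev Colorings (Δ k ℓ : ℕ) : Type := (completeTree Δ ℓ).Coloring (Fin k)

instance (Δ k ℓ : ℕ) : Finite (Colorings Δ k ℓ) := DFunLike.finite _

instance (Δ k ℓ : ℕ) : MeasurableSpace (Colorings Δ k ℓ) := ⊤

instance (Δ k ℓ : ℕ) : DiscreteMeasurableSpace (Colorings Δ k ℓ) := ⟨fun _ => trivial⟩

/-- The uniform probability measure `μ_ℓ` on the proper `k`-colorings of `T_ℓ`. -/
noncomputable def mu (Δ k ℓ : ℕ) : Measure (Colorings Δ k ℓ) := uniformOn Set.univ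

/-- The event `σ(root) = c`. -/
def rootEvent {Δ k ℓ : ℕ} (c : Fin k) : Set (Colorings Δ k ℓ) := {σ | σ (root Δ ℓ) = c}

/-- The event `σ(L) = τ(L)`. -/
def leafEvent {Δ k ℓ : ℕ} (τ : Colorings Δ k ℓ) : Set (Colorings Δ k ℓ) :=
  {σ | ∀ v ∈ leaves Δ ℓ, σ v = τ v}

/-- The conditional probability `μ_ℓ(σ(root) = c | σ(L) = τ(L))`. -/
noncomputable def rootMarginal {Δ k ℓ : ℕ} (τ : Colorings Δ k ℓ) (c : Fin k) : ℝ :=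
  (ProbabilityTheory.cond (mu Δ k ℓ) (leafEvent τ)).real (rootEvent c)

end TreeColoring

/-! Given the leaves, the posterior weight of colour `c` at a vertex is proportional to the product
over its children of one minus the child's posterior of `c`. The leaves thus define a channel from
the root colour to observations, built one level at a time by `step`, in which the children are
independent given the colour of their parent. The proof follows the relative deviation `|k * post -
1|` up the tree at the scale `X = Δ ^ (ε / 64)`.

The core is `Scale.prob_treeChannel_le`: at depth `2 * r + u` the deviation exceeds the `r`-th
threshold with probability at most `exp (-X ^ u)`, for every root colour. The zeroth threshold is
large but still small compared with `k`; the later ones are `X ^ (-2 * r)`. Taking `r` to be about a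
quarter of the depth makes both exponents linear in the depth.

Since `k` exceeds `(1 + ε) Δ / ln Δ`, a vertex above the leaves typically leaves about `k * exp (-Δ
/ k)` colours unused, enough for the zeroth threshold (`prob_unused_lt_le`). That threshold persists
because a few biased children cannot destroy the partition function (`le_sum_prod_one_sub`), so
failure needs many failed children and the exponent grows by a factor `X` per level
(`Scale.prob_step_zero`).

To pass from one threshold to the next, colour symmetry makes the children's deviations nearly
centred, so their sum concentrates and the logarithm of the product hardly depends on the colour
(`good_step`, `Scale.prob_step_contract`). The concentration estimate is used only for `u ≤ 3`, its
exponent being independent of the depth. For larger `u`, `Scale.prob_step_robust` needs no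
cancellation: most children already satisfy the threshold two steps further on, fewer than `X ^ 8`
do not, and even these satisfy the previous one.

Finally, colouring counts obey the recursion of the channel up to normalisation
(`exists_colorCount_eq`), which transfers the estimate to the uniform measure. -/

namespace TreeColoring

open Finset

/-! ### Channels on trees, posteriors and exponential moments -/

section Channel

variable {β : Type*} {Δ k : ℕ}

/-- Every permutation of the colours is realised by a permutation of the observations. -/
def IsColorSymmetric (p : Fin k → β → ℝ) : Prop :=
  ∀ π : Equiv.Perm (Fin k), ∃ e : Equiv.Perm β, ∀ j b, p (π j) (e b) = p j b

/-- The total weight of an observation. -/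
def mass (p : Fin k → β → ℝ) (b : β) : ℝ := ∑ j, p j b

/-- The posterior probability that the root has colour `c`. -/
noncomputable def post (p : Fin k → β → ℝ) (b : β) (c : Fin k) : ℝ := p c b / mass p b

/-- The law of the observation at a child of a vertex of colour `s`. -/
noncomputable def childLik (p : Fin k → β → ℝ) (s : Fin k) (b : β) : ℝ :=
  (∑ j ∈ univ.erase s, p j b) / ((k : ℝ) - 1)

/-- The channel of a vertex whose `Δ` children carry the channel `p`. -/
noncomputable def step (Δ : ℕ) (p : Fin k → β → ℝ) (s : Fin k) (b : Fin Δ → β) : ℝ :=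
  ∏ i, childLik p s (b i)

/-- The posterior is within relative error `θ` of the uniform distribution. -/
def Good (p : Fin k → β → ℝ) (θ : ℝ) (b : β) : Prop :=
  mass p b ≠ 0 ∧ ∀ c, |(k : ℝ) * post p b c - 1| ≤ θ

variable {p : Fin k → β → ℝ}

lemma childLik_eq (s : Fin k) (b : β) :
    childLik p s b = (mass p b - p s b) / ((k : ℝ) - 1) := by
  unfold childLik mass
  rw [← Finset.add_sum_erase univ (fun j => p j b) (mem_univ s), add_sub_cancel_left]

lemma childLik_eq_post {b : β} (hb : mass p b ≠ 0) (s : Fin k) :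
    childLik p s b = mass p b / ((k : ℝ) - 1) * (1 - post p b s) := by
  rw [childLik_eq, post]
  field_simp

lemma sum_post {b : β} (hb : mass p b ≠ 0) : ∑ c, post p b c = 1 := by
  unfold post
  rw [← sum_div]
  exact div_self hb

lemma mass_perm {π : Equiv.Perm (Fin k)} {e : Equiv.Perm β}
    (he : ∀ j b, p (π j) (e b) = p j b) (b : β) : mass p (e b) = mass p b := by
  unfold mass
  rw [← Equiv.sum_comp π]
  exact sum_congr rfl fun j _ => he j _

lemma post_perm {π : Equiv.Perm (Fin k)} {e : Equiv.Perm β}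
    (he : ∀ j b, p (π j) (e b) = p j b) (b : β) (c : Fin k) :
    post p (e b) (π c) = post p b c := by
  rw [post, post, mass_perm he, he]

lemma good_perm {π : Equiv.Perm (Fin k)} {e : Equiv.Perm β}
    (he : ∀ j b, p (π j) (e b) = p j b) {θ : ℝ} (b : β) : Good p θ (e b) ↔ Good p θ b := by
  unfold Good
  rw [mass_perm he]
  refine and_congr Iff.rfl ⟨fun h c => ?_, fun h c => ?_⟩
  · rw [← post_perm he]
    exact h _
  · obtain ⟨c, rfl⟩ := π.surjective c
    rw [post_perm he]
    exact h c

lemma mass_step (b : Fin Δ → β) (hb : ∀ i, mass p (b i) ≠ 0) (c : Fin k) :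
    step Δ p c b = (∏ i, mass p (b i) / ((k : ℝ) - 1)) * ∏ i, (1 - post p (b i) c) := by
  unfold step
  rw [← prod_mul_distrib]
  exact prod_congr rfl fun i _ => childLik_eq_post (hb i) c

lemma post_step (hk : 2 ≤ k) (b : Fin Δ → β) (hb : ∀ i, mass p (b i) ≠ 0) (c : Fin k) :
    post (step Δ p) b c =
      (∏ i, (1 - post p (b i) c)) / ∑ c', ∏ i, (1 - post p (b i) c') := by
  have hk' : (2 : ℝ) ≤ k := by exact_mod_cast hk
  have h0 : (∏ i, mass p (b i) / ((k : ℝ) - 1)) ≠ 0 :=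
    prod_ne_zero_iff.2 fun i _ => div_ne_zero (hb i) (by linarith)
  unfold post
  rw [mass]
  simp_rw [mass_step b hb]
  rw [← mul_sum, mul_div_mul_left _ _ h0]
  rfl

lemma IsColorSymmetric.step (hp : IsColorSymmetric p) : IsColorSymmetric (step Δ p) := by
  intro π
  obtain ⟨e, he⟩ := hp π
  refine ⟨Equiv.piCongrRight fun _ => e, fun j b => ?_⟩
  unfold TreeColoring.step
  refine prod_congr rfl fun i _ => ?_
  simp only [Equiv.piCongrRight_apply, Pi.map_apply]
  rw [childLik_eq, childLik_eq, he]
  congr 2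
  unfold mass
  rw [← Equiv.sum_comp π]
  exact sum_congr rfl fun j _ => he j _

variable [Fintype β]

/-- A family of probability weights on `β`, indexed by the colour of the root. -/
structure IsChannel (p : Fin k → β → ℝ) : Prop where
  nonneg : ∀ j b, 0 ≤ p j b
  sum_eq_one : ∀ j, ∑ b, p j b = 1

open Classical in
/-- The probability of an event given the colour of the root. -/
noncomputable def prob (p : Fin k → β → ℝ) (s : Fin k) (E : β → Prop) : ℝ :=
  ∑ b with E b, p s b

lemma IsChannel.mass_nonneg (hp : IsChannel p) (b : β) : 0 ≤ mass p b :=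
  sum_nonneg fun j _ => hp.nonneg j b

lemma IsChannel.le_mass (hp : IsChannel p) (j : Fin k) (b : β) : p j b ≤ mass p b :=
  single_le_sum (f := fun j => p j b) (fun j _ => hp.nonneg j b) (mem_univ j)

lemma IsChannel.sum_mass (hp : IsChannel p) : ∑ b, mass p b = k := by
  unfold mass
  rw [sum_comm]
  simp [hp.sum_eq_one]

lemma IsChannel.post_nonneg (hp : IsChannel p) (b : β) (c : Fin k) : 0 ≤ post p b c :=
  div_nonneg (hp.nonneg c b) (hp.mass_nonneg b)

lemma IsChannel.mass_mul_post (hp : IsChannel p) (b : β) (c : Fin k) :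
    mass p b * post p b c = p c b := by
  unfold post
  by_cases h : mass p b = 0
  · have := hp.le_mass c b
    have := hp.nonneg c b
    rw [h] at *
    simp
    linarith
  · field_simp

lemma IsChannel.childLik_nonneg (hp : IsChannel p) (hk : 2 ≤ k) (s : Fin k) (b : β) :
    0 ≤ childLik p s b := by
  have : (2 : ℝ) ≤ k := by exact_mod_cast hk
  exact div_nonneg (sum_nonneg fun j _ => hp.nonneg j b) (by linarith)

lemma sum_childLik_mul_le (hk : 2 ≤ k) (s : Fin k) {f : β → ℝ}
    {q : ℝ} (hf : ∀ j, ∑ b, p j b * f b ≤ q) : ∑ b, childLik p s b * f b ≤ q := by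
  have hk' : (2 : ℝ) ≤ k := by exact_mod_cast hk
  have h : ∑ b, childLik p s b * f b = (∑ j ∈ univ.erase s, ∑ b, p j b * f b) / ((k : ℝ) - 1) := by
    rw [sum_comm, sum_div]
    refine sum_congr rfl fun b _ => ?_
    rw [childLik, ← sum_mul]
    ring
  rw [h, div_le_iff₀ (by linarith)]
  calc ∑ j ∈ univ.erase s, ∑ b, p j b * f b ≤ ∑ j ∈ univ.erase s, q :=
        sum_le_sum fun j _ => hf j
    _ = q * ((k : ℝ) - 1) := by
        rw [sum_const, card_erase_of_mem (mem_univ s), card_univ, Fintype.card_fin, nsmul_eq_mul,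
          Nat.cast_sub (by omega)]
        push_cast
        ring

lemma IsChannel.sum_childLik (hp : IsChannel p) (hk : 2 ≤ k) (s : Fin k) :
    ∑ b, childLik p s b = 1 := by
  have hk' : (2 : ℝ) ≤ k := by exact_mod_cast hk
  simp_rw [childLik_eq]
  rw [← sum_div, sum_sub_distrib, hp.sum_mass, hp.sum_eq_one]
  exact div_self (by linarith)

lemma IsChannel.step (hp : IsChannel p) (hk : 2 ≤ k) : IsChannel (step Δ p) where
  nonneg s _ := prod_nonneg fun i _ => hp.childLik_nonneg hk s _
  sum_eq_one s := by
    have := (Finset.prod_univ_sum (fun _ : Fin Δ => (univ : Finset β))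
      (fun _ b => childLik p s b)).symm
    rw [Fintype.piFinset_univ] at this
    unfold TreeColoring.step
    rw [this, hp.sum_childLik hk]
    simp

lemma IsChannel.mass_child_ne_zero (hp : IsChannel p) {s : Fin k} {b : Fin Δ → β}
    (h : TreeColoring.step Δ p s b ≠ 0) (i : Fin Δ) : mass p (b i) ≠ 0 := by
  intro h0
  refine prod_ne_zero_iff.1 h i (mem_univ i) ?_
  have h1 := hp.le_mass s (b i)
  have h2 := hp.nonneg s (b i)
  rw [childLik_eq, h0, show p s (b i) = 0 by linarith]
  simp

lemma IsChannel.mass_ne_zero (hp : IsChannel p) {s : Fin k} {b : β} (h : p s b ≠ 0) :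
    mass p b ≠ 0 := by
  have h1 := hp.le_mass s b
  have h2 := hp.nonneg s b
  have : 0 < p s b := lt_of_le_of_ne h2 (Ne.symm h)
  linarith

lemma prob_eq_sum_ite (s : Fin k) (E : β → Prop) [DecidablePred E] :
    prob p s E = ∑ b, if E b then p s b else 0 := by
  unfold prob
  rw [sum_filter]
  exact sum_congr rfl fun b _ => by congr

/-- The implication is needed only at observations of positive weight. There the masses of the
observation and of its children are nonzero, so no posterior is a division by zero. -/
lemma IsChannel.prob_le (hp : IsChannel p) {s : Fin k} {E F : β → Prop}
    (h : ∀ b, p s b ≠ 0 → E b → F b) : prob p s E ≤ prob p s F := by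
  classical
  rw [prob_eq_sum_ite, prob_eq_sum_ite]
  refine sum_le_sum fun b _ => ?_
  by_cases h0 : p s b = 0
  · simp [h0]
  · have := hp.nonneg s b
    split_ifs with h1 h2
    · exact le_rfl
    · exact absurd (h b h0 h1) h2
    · exact this
    · exact le_rfl

lemma IsChannel.prob_or_le (hp : IsChannel p) (s : Fin k) (E F : β → Prop) :
    prob p s (fun b => E b ∨ F b) ≤ prob p s E + prob p s F := by
  classical
  rw [prob_eq_sum_ite, prob_eq_sum_ite, prob_eq_sum_ite, ← sum_add_distrib]
  refine sum_le_sum fun b _ => ?_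
  have := hp.nonneg s b
  by_cases hE : E b <;> by_cases hF : F b <;> simp [hE, hF, this]

lemma IsChannel.prob_exists_le (hp : IsChannel p) {ι : Type*} [Fintype ι] (s : Fin k)
    (E : ι → β → Prop) : prob p s (fun b => ∃ i, E i b) ≤ ∑ i, prob p s (E i) := by
  classical
  simp_rw [prob_eq_sum_ite]
  rw [sum_comm]
  refine sum_le_sum fun b _ => ?_
  have := hp.nonneg s b
  split_ifs with h
  · obtain ⟨i, hi⟩ := h
    refine le_trans ?_ (single_le_sum (f := fun i => if E i b then p s b else 0)
      (fun i _ => by split_ifs <;> simp [this]) (mem_univ i))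
    simp [hi]
  · exact sum_nonneg fun i _ => by split_ifs <;> simp [this]

/-- The exponential moment bound for sums over independent children. -/
lemma IsChannel.prob_step_le_exp (hp : IsChannel p) (hk : 2 ≤ k) (s : Fin k) (f : β → ℝ)
    {M : ℝ} (hM : ∑ b, childLik p s b * Real.exp (f b) ≤ M) (t : ℝ) :
    prob (TreeColoring.step Δ p) s (fun b => t ≤ ∑ i, f (b i)) ≤ Real.exp (-t) * M ^ Δ := by
  classical
  rw [prob_eq_sum_ite]
  have h0 : 0 ≤ ∑ b, childLik p s b * Real.exp (f b) :=
    sum_nonneg fun b _ => mul_nonneg (hp.childLik_nonneg hk s b) (Real.exp_pos _).le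
  calc _ ≤ ∑ b : Fin Δ → β, Real.exp (-t) * ∏ i, childLik p s (b i) * Real.exp (f (b i)) := by
        refine sum_le_sum fun b _ => ?_
        have h1 : 0 ≤ TreeColoring.step Δ p s b := (hp.step hk).nonneg s b
        have h2 : Real.exp (-t) * ∏ i, childLik p s (b i) * Real.exp (f (b i)) =
            TreeColoring.step Δ p s b * Real.exp (-t + ∑ i, f (b i)) := by
          rw [prod_mul_distrib, Real.exp_add, Real.exp_sum, TreeColoring.step]
          ring
        rw [h2]
        split_ifs with h
        · exact le_mul_of_one_le_right h1 (Real.one_le_exp (by linarith))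
        · exact mul_nonneg h1 (Real.exp_pos _).le
    _ = Real.exp (-t) * (∑ b, childLik p s b * Real.exp (f b)) ^ Δ := by
        rw [← mul_sum]
        have := (Finset.prod_univ_sum (fun _ : Fin Δ => (univ : Finset β))
          (fun _ b => childLik p s b * Real.exp (f b))).symm
        rw [Fintype.piFinset_univ] at this
        rw [this]
        simp
    _ ≤ _ := by gcongr

/-- It is unlikely that many children are exceptional. -/
lemma IsChannel.prob_step_card_le (hp : IsChannel p) (hk : 2 ≤ k) {E : β → Prop} [DecidablePred E]
    {x : ℝ} (hx : 0 ≤ x) (hE : ∀ j, prob p j E ≤ Real.exp (-x)) (hΔ : Δ * Real.exp (-(x / 2)) ≤ 1)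
    (s : Fin k) (m : ℝ) :
    prob (TreeColoring.step Δ p) s (fun b => m ≤ #{i | E (b i)}) ≤
      Real.exp (1 - m * (x / 2)) := by
  -- Half of the exponent `x` is spent on the tilt. The other half leaves `exp (-(x / 2))` per
  -- child, so the `Δ` children together cost at most a factor `e`.
  set f : β → ℝ := fun b => if E b then x / 2 else 0 with hf
  have hM : ∑ b, childLik p s b * Real.exp (f b) ≤ 1 + Real.exp (-(x / 2)) := by
    refine sum_childLik_mul_le hk s fun j => ?_
    calc ∑ b, p j b * Real.exp (f b)
        ≤ ∑ b, (p j b + Real.exp (x / 2) * if E b then p j b else 0) := by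
          refine sum_le_sum fun b _ => ?_
          have := hp.nonneg j b
          simp only [hf]
          split_ifs
          · nlinarith
          · simp
      _ = 1 + Real.exp (x / 2) * prob p j E := by
          rw [sum_add_distrib, hp.sum_eq_one, ← mul_sum, prob_eq_sum_ite]
      _ ≤ 1 + Real.exp (x / 2) * Real.exp (-x) := by
          gcongr
          exact hE j
      _ = 1 + Real.exp (-(x / 2)) := by
          rw [← Real.exp_add]
          ring_nf
  have h1 := hp.prob_step_le_exp (Δ := Δ) hk s f hM (m * (x / 2))
  have h2 : ∀ b : Fin Δ → β, ∑ i, f (b i) = #{i | E (b i)} * (x / 2) := by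
    intro b
    simp only [hf]
    rw [← sum_filter, sum_const, nsmul_eq_mul]
  calc _ ≤ prob (TreeColoring.step Δ p) s (fun b => m * (x / 2) ≤ ∑ i, f (b i)) := by
        refine (hp.step hk).prob_le fun b _ h => ?_
        rw [h2]
        gcongr
    _ ≤ _ := h1
    _ ≤ Real.exp (-(m * (x / 2))) * Real.exp 1 := by
        gcongr
        calc (1 + Real.exp (-(x / 2))) ^ Δ ≤ (Real.exp (Real.exp (-(x / 2)))) ^ Δ := by
              gcongr
              rw [add_comm]
              exact Real.add_one_le_exp _
          _ = Real.exp (Δ * Real.exp (-(x / 2))) := by rw [Real.exp_nat_mul]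
          _ ≤ Real.exp 1 := Real.exp_le_exp.2 hΔ
    _ = _ := by
        rw [← Real.exp_add]
        ring_nf

end Channel

end TreeColoring

namespace TreeColoring

open Finset

/-! ### Mean, variance and concentration of the children's deviations -/

section Fluctuation

variable {β : Type*} {Δ k : ℕ} {p : Fin k → β → ℝ}

open Classical in
/-- The relative deviation of the posterior of the colour `c`, truncated outside `Good p θ`. -/
noncomputable def truncDev (p : Fin k → β → ℝ) (θ : ℝ) (c : Fin k) (b : β) : ℝ :=
  if Good p θ b then k * post p b c - 1 else 0

lemma truncDev_of_good {θ : ℝ} {b : β} (h : Good p θ b) (c : Fin k) :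
    truncDev p θ c b = k * post p b c - 1 := if_pos h

lemma abs_truncDev_le {θ : ℝ} (hθ : 0 ≤ θ) (c : Fin k) (b : β) : |truncDev p θ c b| ≤ θ := by
  unfold truncDev
  split_ifs with h
  · exact h.2 c
  · simpa using hθ

lemma sum_truncDev (θ : ℝ) (b : β) : ∑ c, truncDev p θ c b = 0 := by
  unfold truncDev
  split_ifs with h
  · rw [sum_sub_distrib, ← mul_sum, sum_post h.1]
    simp
  · simp

variable [Fintype β]

/-- Swapping two colours shows that this mean does not depend on `c`, since the truncation event is
itself invariant under permutations. Summed over all colours the deviations vanish pointwise, so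
each mean is zero. -/
lemma IsColorSymmetric.sum_mass_mul_truncDev (hs : IsColorSymmetric p) (θ : ℝ) (c : Fin k) :
    ∑ b, mass p b * truncDev p θ c b = 0 := by
  have h1 : ∀ c', ∑ b, mass p b * truncDev p θ c' b = ∑ b, mass p b * truncDev p θ c b := by
    intro c'
    obtain ⟨e, he⟩ := hs (Equiv.swap c c')
    rw [← Equiv.sum_comp e]
    refine sum_congr rfl fun b _ => ?_
    rw [mass_perm he]
    congr 1
    have h2 := post_perm he b c
    rw [Equiv.swap_apply_left] at h2
    have h3 := good_perm he (θ := θ) b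
    unfold truncDev
    rw [h2]
    split_ifs <;> tauto
  have h2 : ∑ c', ∑ b, mass p b * truncDev p θ c' b = 0 := by
    rw [sum_comm]
    refine sum_eq_zero fun b _ => ?_
    rw [← mul_sum, sum_truncDev, mul_zero]
  simp_rw [h1] at h2
  rw [sum_const, card_univ, Fintype.card_fin, nsmul_eq_mul, mul_eq_zero] at h2
  have : (k : ℝ) ≠ 0 := by
    have := c.pos
    positivity
  exact h2.resolve_left this

/-- A child's law is `mass - p s`, normalised by `k - 1`. The first term contributes a zero mean by
symmetry, so the bias is only that of one colour out of `k - 1`. -/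
lemma IsChannel.abs_sum_childLik_mul_truncDev_le (hp : IsChannel p) (hs : IsColorSymmetric p)
    (hk : 2 ≤ k) {θ : ℝ} (hθ : 0 ≤ θ) (s c : Fin k) :
    |∑ b, childLik p s b * truncDev p θ c b| ≤ θ / ((k : ℝ) - 1) := by
  have hk' : (2 : ℝ) ≤ k := by exact_mod_cast hk
  have h1 : ∑ b, childLik p s b * truncDev p θ c b =
      -(∑ b, p s b * truncDev p θ c b) / ((k : ℝ) - 1) := by
    rw [neg_eq_zero_sub, ← hs.sum_mass_mul_truncDev θ c, ← sum_sub_distrib, sum_div]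
    refine sum_congr rfl fun b _ => ?_
    rw [childLik_eq]
    ring
  rw [h1, abs_div, abs_neg, abs_of_pos (by linarith : (0 : ℝ) < k - 1)]
  refine div_le_div_of_nonneg_right ?_ (by linarith)
  calc _ ≤ ∑ b, |p s b * truncDev p θ c b| := abs_sum_le_sum_abs _ _
    _ ≤ ∑ b, p s b * θ := by
        refine sum_le_sum fun b _ => ?_
        rw [abs_mul, abs_of_nonneg (hp.nonneg s b)]
        exact mul_le_mul_of_nonneg_left (abs_truncDev_le hθ c b) (hp.nonneg s b)
    _ = θ := by rw [← sum_mul, hp.sum_eq_one, one_mul]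

lemma IsChannel.sum_childLik_mul_sq_le (hp : IsChannel p) (hk : 2 ≤ k) {θ : ℝ} (hθ : 0 ≤ θ)
    (s c : Fin k) : ∑ b, childLik p s b * truncDev p θ c b ^ 2 ≤ θ ^ 2 := by
  refine sum_childLik_mul_le hk s fun j => ?_
  calc _ ≤ ∑ b, p j b * θ ^ 2 := by
        refine sum_le_sum fun b _ => mul_le_mul_of_nonneg_left ?_ (hp.nonneg j b)
        exact sq_le_sq' (neg_le_of_abs_le (abs_truncDev_le hθ c b))
          (le_of_abs_le (abs_truncDev_le hθ c b))
    _ = θ ^ 2 := by rw [← sum_mul, hp.sum_eq_one, one_mul]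

/-- Linear in `θ`, hence useful when `θ` is large: one factor is bounded by `θ` and the other by `1
+ k * post`, whose mean is at most 3 because `k * post` weighted by the child law is at most `k / (k
- 1)` times `p c`. -/
lemma IsChannel.sum_childLik_mul_sq_le' (hp : IsChannel p) (hk : 2 ≤ k) {θ : ℝ} (hθ : 0 ≤ θ)
    (s c : Fin k) : ∑ b, childLik p s b * truncDev p θ c b ^ 2 ≤ 3 * θ := by
  have hk' : (2 : ℝ) ≤ k := by exact_mod_cast hk
  calc _ ≤ ∑ b, θ * (childLik p s b + k / ((k : ℝ) - 1) * p c b) := by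
        refine sum_le_sum fun b _ => ?_
        have hc := hp.childLik_nonneg hk s b
        have hpost := hp.post_nonneg b c
        have h1 : childLik p s b * (k * post p b c) ≤ k / ((k : ℝ) - 1) * p c b := by
          rw [← hp.mass_mul_post b c]
          calc _ ≤ mass p b / ((k : ℝ) - 1) * (k * post p b c) := by
                refine mul_le_mul_of_nonneg_right ?_ (by positivity)
                rw [childLik_eq]
                refine div_le_div_of_nonneg_right ?_ (by linarith)
                linarith [hp.nonneg s b]
            _ = _ := by ring
        have h2 : truncDev p θ c b ^ 2 ≤ θ * (1 + k * post p b c) := by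
          have h3 : |truncDev p θ c b| ≤ 1 + k * post p b c := by
            have : 0 ≤ k * post p b c := by positivity
            unfold truncDev
            split_ifs
            · rw [abs_le]
              constructor <;> linarith
            · simp
              linarith
          rw [← sq_abs, sq]
          exact mul_le_mul (abs_truncDev_le hθ c b) h3 (abs_nonneg _) hθ
        calc _ ≤ childLik p s b * (θ * (1 + k * post p b c)) := by gcongr
          _ = θ * (childLik p s b + childLik p s b * (k * post p b c)) := by ring
          _ ≤ _ := by gcongr
    _ = θ * (1 + k / ((k : ℝ) - 1)) := by
        rw [← mul_sum, sum_add_distrib, hp.sum_childLik hk, ← mul_sum, hp.sum_eq_one, mul_one]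
    _ ≤ θ * 3 := by
        gcongr
        have : k / ((k : ℝ) - 1) ≤ 2 := by
          rw [div_le_iff₀ (by linarith)]
          linarith
        linarith
    _ = _ := by ring

lemma sum_childLik_mul_exp_le (hp : IsChannel p) (hk : 2 ≤ k) (s : Fin k) {f : β → ℝ} {μ V : ℝ}
    (hf : ∀ b, |f b| ≤ 1) (hμ : ∑ b, childLik p s b * f b ≤ μ)
    (hV : ∑ b, childLik p s b * f b ^ 2 ≤ V) :
    ∑ b, childLik p s b * Real.exp (f b) ≤ Real.exp (μ + V) := by
  calc _ ≤ ∑ b, (childLik p s b + childLik p s b * f b + childLik p s b * f b ^ 2) := by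
        refine sum_le_sum fun b _ => ?_
        have h1 := Real.abs_exp_sub_one_sub_id_le (hf b)
        have h2 := le_of_abs_le h1
        nlinarith [hp.childLik_nonneg hk s b]
    _ ≤ (μ + V) + 1 := by
        rw [sum_add_distrib, sum_add_distrib, hp.sum_childLik hk]
        linarith
    _ ≤ _ := Real.add_one_le_exp _

/-- Concentration of the sum of the truncated deviations over the children. -/
lemma IsChannel.prob_step_truncDev_le (hp : IsChannel p) (hs : IsColorSymmetric p) (hk : 2 ≤ k)
    {θ V lam : ℝ} (hθ : 0 ≤ θ) (hlam : 0 ≤ lam) (hlamθ : lam * θ ≤ 1)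
    (hV : ∀ s c, ∑ b, childLik p s b * truncDev p θ c b ^ 2 ≤ V) (s : Fin k) (t : ℝ) :
    prob (TreeColoring.step Δ p) s (fun b => ∃ c, t ≤ |∑ i, truncDev p θ c (b i)|) ≤
      2 * k * Real.exp (-(lam * t) + Δ * (lam * θ / ((k : ℝ) - 1) + lam ^ 2 * V)) := by
  set R := Real.exp (-(lam * t) + Δ * (lam * θ / ((k : ℝ) - 1) + lam ^ 2 * V)) with hR
  have key : ∀ (σ : ℝ), |σ| = 1 → ∀ c, prob (TreeColoring.step Δ p) s
      (fun b => lam * t ≤ ∑ i, σ * lam * truncDev p θ c (b i)) ≤ R := by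
    intro σ hσ c
    have hM : ∑ b, childLik p s b * Real.exp (σ * lam * truncDev p θ c b) ≤
        Real.exp (lam * θ / ((k : ℝ) - 1) + lam ^ 2 * V) := by
      refine sum_childLik_mul_exp_le hp hk s (fun b => ?_) ?_ ?_
      · rw [abs_mul, abs_mul, hσ, one_mul, abs_of_nonneg hlam]
        exact (mul_le_mul_of_nonneg_left (abs_truncDev_le hθ c b) hlam).trans hlamθ
      · refine le_of_abs_le ?_
        have : ∑ b, childLik p s b * (σ * lam * truncDev p θ c b) =
            σ * lam * ∑ b, childLik p s b * truncDev p θ c b := by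
          rw [mul_sum]
          exact sum_congr rfl fun b _ => by ring
        rw [this, abs_mul, abs_mul, hσ, one_mul, abs_of_nonneg hlam, mul_div_assoc]
        exact mul_le_mul_of_nonneg_left (hp.abs_sum_childLik_mul_truncDev_le hs hk hθ s c) hlam
      · have : ∑ b, childLik p s b * (σ * lam * truncDev p θ c b) ^ 2 =
            lam ^ 2 * ∑ b, childLik p s b * truncDev p θ c b ^ 2 := by
          rw [mul_sum]
          refine sum_congr rfl fun b _ => ?_
          have : σ ^ 2 = 1 := by rw [← sq_abs, hσ, one_pow]
          rw [mul_pow, mul_pow, this]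
          ring
        rw [this]
        exact mul_le_mul_of_nonneg_left (hV s c) (sq_nonneg _)
    refine (hp.prob_step_le_exp hk s _ hM _).trans (le_of_eq ?_)
    rw [hR, ← Real.exp_nat_mul, ← Real.exp_add]
  calc _ ≤ ∑ c, prob (TreeColoring.step Δ p) s (fun b => t ≤ |∑ i, truncDev p θ c (b i)|) :=
        (hp.step hk).prob_exists_le s _
    _ ≤ ∑ _c : Fin k, (R + R) := by
        refine sum_le_sum fun c _ => ?_
        refine le_trans ?_ (add_le_add (key 1 (by simp) c) (key (-1) (by simp) c))
        refine le_trans ?_ ((hp.step hk).prob_or_le _ _ _)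
        refine (hp.step hk).prob_le fun b _ h => ?_
        simp_rw [← mul_sum]
        rcases le_abs.1 h with h | h
        · left
          rw [one_mul]
          gcongr
        · right
          rw [neg_one_mul, neg_mul, ← mul_neg]
          gcongr
    _ = _ := by
        rw [sum_const, card_univ, Fintype.card_fin, nsmul_eq_mul]
        ring

end Fluctuation

end TreeColoring

namespace TreeColoring

open Finset

/-! ### Deterministic estimates for one step of the recursion -/

section Deterministic

lemma abs_sum_log_one_sub_le {ι : Type*} (s : Finset ι) (u : ι → ℝ) (hu : ∀ i, |u i| ≤ 1 / 2) :
    |∑ i ∈ s, Real.log (1 - u i)| ≤ |∑ i ∈ s, u i| + 2 * ∑ i ∈ s, u i ^ 2 := by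
  have h1 : ∀ i, |u i + Real.log (1 - u i)| ≤ 2 * u i ^ 2 := by
    intro i
    have h := Real.abs_log_sub_add_sum_range_le (x := u i) ((hu i).trans_lt (by norm_num)) 1
    simp only [range_one, sum_singleton, zero_add, pow_one, Nat.cast_zero, div_one] at h
    refine h.trans ?_
    rw [div_le_iff₀ (by linarith [hu i])]
    change |u i| ^ 2 ≤ _
    rw [sq_abs]
    nlinarith [sq_nonneg (u i), hu i, abs_nonneg (u i), sq_abs (u i)]
  have h2 : ∑ i ∈ s, Real.log (1 - u i) =
      -(∑ i ∈ s, u i) + ∑ i ∈ s, (u i + Real.log (1 - u i)) := by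
    rw [sum_add_distrib]
    ring
  rw [h2]
  refine (abs_add_le _ _).trans ?_
  rw [abs_neg, mul_sum]
  gcongr
  exact (abs_sum_le_sum_abs _ _).trans (sum_le_sum fun i _ => h1 i)

/-- Each weight and the average weight lie within a factor `exp r` of `A`, so their ratio lies
between `exp (-2 * r)` and `exp (2 * r) ≤ 1 + 4 * r`. -/
lemma abs_card_mul_div_sum_sub_one_le {k : ℕ} {w L : Fin k → ℝ} {A r : ℝ} (hA : 0 < A)
    (hw : ∀ c, w c = A * Real.exp (L c)) (hL : ∀ c, |L c| ≤ r) (hr : r ≤ 1 / 2) (c : Fin k) :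
    |(k : ℝ) * (w c / ∑ c', w c') - 1| ≤ 4 * r := by
  have hk : (0 : ℝ) < k := by exact_mod_cast c.pos
  have hr0 : 0 ≤ r := (abs_nonneg _).trans (hL c)
  set Z := ∑ c', Real.exp (L c') with hZ
  have hsum : ∑ c', w c' = A * Z := by
    simp_rw [hw]
    rw [← mul_sum]
  have hlo : k * Real.exp (-r) ≤ Z := by
    calc k * Real.exp (-r) = ∑ _c : Fin k, Real.exp (-r) := by simp
      _ ≤ Z := sum_le_sum fun c' _ => Real.exp_le_exp.2 (neg_le_of_abs_le (hL c'))
  have hhi : Z ≤ k * Real.exp r := by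
    calc Z ≤ ∑ _c : Fin k, Real.exp r :=
        sum_le_sum fun c' _ => Real.exp_le_exp.2 (le_of_abs_le (hL c'))
      _ = _ := by simp
  have hZ0 : 0 < Z := lt_of_lt_of_le (by positivity) hlo
  have hq : (k : ℝ) * (w c / ∑ c', w c') = k * Real.exp (L c) / Z := by
    rw [hsum, hw]
    field_simp
  have h1 : k * Real.exp (L c) / Z ≤ Real.exp (2 * r) := by
    rw [div_le_iff₀ hZ0]
    calc k * Real.exp (L c) ≤ k * Real.exp r := by
          gcongr
          exact le_of_abs_le (hL c)
      _ = Real.exp (2 * r) * (k * Real.exp (-r)) := by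
          rw [mul_left_comm, ← Real.exp_add]
          ring_nf
      _ ≤ _ := by gcongr
  have h2 : Real.exp (-(2 * r)) ≤ k * Real.exp (L c) / Z := by
    rw [le_div_iff₀ hZ0]
    calc Real.exp (-(2 * r)) * Z ≤ Real.exp (-(2 * r)) * (k * Real.exp r) := by gcongr
      _ = k * Real.exp (-r) := by
          rw [mul_left_comm, ← Real.exp_add]
          ring_nf
      _ ≤ _ := by
          gcongr
          exact neg_le_of_abs_le (hL c)
  have h3 := Real.abs_exp_sub_one_sub_id_le (x := 2 * r) (by rw [abs_of_nonneg] <;> linarith)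
  have h4 := le_of_abs_le h3
  have h5 := Real.add_one_le_exp (-(2 * r))
  rw [hq, abs_le]
  constructor <;> nlinarith

variable {β : Type*} {Δ k : ℕ} {p : Fin k → β → ℝ}

/-- If the children's deviations are small and nearly cancel, the parent is nearly uniform. -/
lemma good_step (hk : 2 ≤ k) {b : Fin Δ → β} (hm : ∀ i, mass p (b i) ≠ 0)
    (hm' : mass (step Δ p) b ≠ 0) {r : ℝ} (hr : r ≤ 1 / 2)
    (hy : ∀ i c, |k * post p (b i) c - 1| ≤ ((k : ℝ) - 1) / 2)
    (hS : ∀ c, |∑ i, (k * post p (b i) c - 1)| / ((k : ℝ) - 1) +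
      2 * (∑ i, (k * post p (b i) c - 1) ^ 2) / ((k : ℝ) - 1) ^ 2 ≤ r) :
    Good (step Δ p) (4 * r) b := by
  have hk' : (2 : ℝ) ≤ k := by exact_mod_cast hk
  have hk1 : (0 : ℝ) < (k : ℝ) - 1 := by linarith
  refine ⟨hm', fun c => ?_⟩
  rw [post_step hk b hm]
  -- With this choice `1 - post = (k - 1) / k * (1 - u)`. The colour-independent factor cancels on
  -- normalisation.
  set u : Fin k → Fin Δ → ℝ := fun c i => (k * post p (b i) c - 1) / ((k : ℝ) - 1) with hu
  have hu2 : ∀ c i, |u c i| ≤ 1 / 2 := by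
    intro c i
    rw [hu]
    dsimp only
    rw [abs_div, abs_of_pos hk1, div_le_iff₀ hk1]
    linarith [hy i c]
  refine abs_card_mul_div_sum_sub_one_le (w := fun c => ∏ i, (1 - post p (b i) c)) (A := (((k : ℝ) - 1) / k) ^ Δ)
    (L := fun c => ∑ i, Real.log (1 - u c i)) (by positivity) (fun c => ?_) (fun c => ?_) hr c
  · rw [Real.exp_sum]
    have : (((k : ℝ) - 1) / k) ^ Δ = ∏ _i : Fin Δ, (((k : ℝ) - 1) / k) := by
      rw [prod_const, card_univ, Fintype.card_fin]
    rw [this, ← prod_mul_distrib]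
    refine prod_congr rfl fun i _ => ?_
    rw [Real.exp_log (by linarith [le_of_abs_le (hu2 c i)]), hu]
    field_simp
    ring
  · refine (abs_sum_log_one_sub_le univ _ (hu2 c)).trans (le_trans (le_of_eq ?_) (hS c))
    rw [hu]
    dsimp only
    simp_rw [div_pow]
    rw [← sum_div, ← sum_div, abs_div, abs_of_pos hk1, mul_div_assoc]

/-- No cancellation between children is required: since each deviation is at most `(k - 1) / 2`, the
quadratic error is dominated by the sum of absolute values. -/
lemma good_step_of_sum_abs_le (hk : 2 ≤ k) {b : Fin Δ → β} (hm : ∀ i, mass p (b i) ≠ 0)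
    (hm' : mass (step Δ p) b ≠ 0) {r : ℝ} (hr : r ≤ 1 / 2)
    (hy : ∀ i c, |k * post p (b i) c - 1| ≤ ((k : ℝ) - 1) / 2)
    (hS : ∀ c, 4 * ∑ i, |k * post p (b i) c - 1| ≤ r * k) :
    Good (step Δ p) (4 * r) b := by
  have hk' : (2 : ℝ) ≤ k := by exact_mod_cast hk
  have hk1 : (0 : ℝ) < (k : ℝ) - 1 := by linarith
  refine good_step hk hm hm' hr hy fun c => ?_
  set S := ∑ i, |k * post p (b i) c - 1| with hSdef
  have h1 : |∑ i, (k * post p (b i) c - 1)| ≤ S := abs_sum_le_sum_abs _ _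
  have h2 : (∑ i, (k * post p (b i) c - 1) ^ 2) ≤ ((k : ℝ) - 1) / 2 * S := by
    rw [hSdef, mul_sum]
    refine sum_le_sum fun i _ => ?_
    rw [← sq_abs, sq]
    exact mul_le_mul_of_nonneg_right (hy i c) (abs_nonneg _)
  calc _ ≤ S / ((k : ℝ) - 1) + 2 * (((k : ℝ) - 1) / 2 * S) / ((k : ℝ) - 1) ^ 2 := by gcongr
    _ = 2 * S / ((k : ℝ) - 1) := by
        field_simp
        ring
    _ ≤ r := by
        rw [div_le_iff₀ hk1]
        have hS0 : 0 ≤ S := sum_nonneg fun i _ => abs_nonneg _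
        have := hS c
        have hr0 : 0 ≤ r := by
          by_contra h
          nlinarith
        nlinarith

lemma exp_neg_div_le_one_sub {x y : ℝ} (hy : 0 ≤ y) (hyx : y ≤ x) (hx : x < 1) :
    Real.exp (-(y / (1 - x))) ≤ 1 - y := by
  have h1 := Real.one_sub_inv_le_log_of_pos (x := 1 - y) (by linarith)
  have h2 : -(y / (1 - x)) ≤ Real.log (1 - y) := by
    refine le_trans ?_ h1
    have h3 : 1 - (1 - y)⁻¹ = -(y / (1 - y)) := by
      have : 1 - y ≠ 0 := by linarith
      field_simp
      ring
    rw [h3]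
    have : y / (1 - y) ≤ y / (1 - x) := by
      apply div_le_div_of_nonneg_left hy <;> linarith
    linarith
  calc _ ≤ Real.exp (Real.log (1 - y)) := Real.exp_le_exp.2 h2
    _ = _ := Real.exp_log (by linarith)

/-- A lower bound for the partition function when few children are strongly biased. -/
lemma le_sum_prod_one_sub {η : Fin Δ → Fin k → ℝ} (h0 : ∀ i c, 0 ≤ η i c)
    (h1 : ∀ i, ∑ c, η i c = 1) {S : Finset (Fin Δ)} {m x : ℝ} (hS : (#S : ℝ) ≤ m) (hm : m < k)
    (hx : x < 1) (hη : ∀ i ∉ S, ∀ c, η i c ≤ x) :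
    (k - m) * Real.exp (-((Δ / (1 - x) + 2 * m) / (k - m))) ≤ ∑ c, ∏ i, (1 - η i c) := by
  classical
  have hle1 : ∀ i c, η i c ≤ 1 := fun i c => by
    rw [← h1 i]
    exact single_le_sum (f := η i) (fun c _ => h0 i c) (mem_univ c)
  -- Each exceptional child can put more than half of its mass on at most one colour. Discarding
  -- these colours costs at most `m` of them, and on the rest every factor has a usable exponential
  -- lower bound.
  set B : Finset (Fin k) := S.biUnion fun i => {c | 1 / 2 < η i c} with hB
  have hBcard : #B ≤ #S := by
    refine (card_biUnion_le).trans ?_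
    rw [card_eq_sum_ones]
    refine sum_le_sum fun i _ => card_le_one.2 fun c hc c' hc' => ?_
    by_contra hne
    have h2 := sum_le_sum_of_subset_of_nonneg (s := {c, c'}) (t := univ) (f := η i)
      (subset_univ _) (fun c _ _ => h0 i c)
    rw [sum_pair hne, h1 i] at h2
    simp only [mem_filter, mem_univ, true_and] at hc hc'
    linarith
  have hkm : 0 < k - m := by linarith
  have hAcard : (k : ℝ) - m ≤ #Bᶜ := by
    rw [card_compl, Fintype.card_fin, Nat.cast_sub (card_finset_fin_le B)]
    have : (#B : ℝ) ≤ #S := by exact_mod_cast hBcard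
    linarith
  set a := (Δ / (1 - x) + 2 * m) / (k - m) with ha
  set e : Fin k → ℝ := fun c => ∑ i, if i ∈ S then 2 * η i c else η i c / (1 - x) with he
  have ha0 : 0 ≤ a := by
    have : (0 : ℝ) ≤ m := le_trans (by positivity) hS
    positivity
  have hterm : ∀ c ∈ Bᶜ, Real.exp (-(e c)) ≤ ∏ i, (1 - η i c) := by
    intro c hc
    rw [he]
    dsimp only
    rw [← sum_neg_distrib, Real.exp_sum]
    refine prod_le_prod (fun i _ => (Real.exp_pos _).le) fun i _ => ?_
    split_ifs with hi
    · have h2 : η i c ≤ 1 / 2 := by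
        by_contra h
        refine (mem_compl.1 hc) (mem_biUnion.2 ⟨i, hi, ?_⟩)
        simpa using h
      have h3 := exp_neg_div_le_one_sub (h0 i c) h2 (by norm_num)
      rwa [show η i c / (1 - 1 / 2) = 2 * η i c by ring] at h3
    · exact exp_neg_div_le_one_sub (h0 i c) (hη i hi c) hx
  have hsum : ∑ c ∈ Bᶜ, e c ≤ a * (k - m) := by
    calc ∑ c ∈ Bᶜ, e c ≤ ∑ c, e c := by
          refine sum_le_sum_of_subset_of_nonneg (subset_univ _) fun c _ _ => ?_
          refine sum_nonneg fun i _ => ?_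
          have := h0 i c
          split_ifs <;> positivity
      _ = ∑ i, if i ∈ S then 2 else 1 / (1 - x) := by
          rw [he, sum_comm]
          refine sum_congr rfl fun i _ => ?_
          split_ifs
          · rw [← mul_sum, h1, mul_one]
          · rw [← sum_div, h1]
      _ ≤ ∑ i : Fin Δ, (1 / (1 - x) + if i ∈ S then 2 else 0) := by
          refine sum_le_sum fun i _ => ?_
          have : 0 ≤ 1 / (1 - x) := by positivity
          split_ifs <;> linarith
      _ = Δ / (1 - x) + 2 * #S := by
          rw [sum_add_distrib, sum_const, card_univ, Fintype.card_fin, nsmul_eq_mul, mul_one_div,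
            sum_ite_mem, univ_inter, sum_const, nsmul_eq_mul]
          ring
      _ ≤ Δ / (1 - x) + 2 * m := by linarith
      _ = a * (k - m) := by
          rw [ha]
          field_simp
  -- Jensen's inequality in tangent-line form at `a`, the total exponent averaged over `k - m`
  -- colours.
  calc (k - m) * Real.exp (-a) ≤ ∑ c ∈ Bᶜ, Real.exp (-a) * (1 + a - e c) := by
        rw [← mul_sum, mul_comm]
        refine mul_le_mul_of_nonneg_left ?_ (Real.exp_pos _).le
        rw [sum_sub_distrib, sum_const, nsmul_eq_mul]
        nlinarith
    _ ≤ ∑ c ∈ Bᶜ, Real.exp (-(e c)) := by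
        refine sum_le_sum fun c _ => ?_
        have h2 : Real.exp (-(e c)) = Real.exp (-a) * Real.exp (a - e c) := by
          rw [← Real.exp_add]
          ring_nf
        rw [h2]
        refine mul_le_mul_of_nonneg_left ?_ (Real.exp_pos _).le
        linarith [Real.add_one_le_exp (a - e c)]
    _ ≤ ∑ c ∈ Bᶜ, ∏ i, (1 - η i c) := sum_le_sum hterm
    _ ≤ _ := sum_le_sum_of_subset_of_nonneg (subset_univ _) fun c _ _ =>
        prod_nonneg fun i _ => by linarith [hle1 i c]

/-- A lower bound on the partition function bounds the posterior. -/
lemma good_step_of_le_partition (hk : 2 ≤ k) {b : Fin Δ → β} (hm : ∀ i, mass p (b i) ≠ 0)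
    (hm' : mass (step Δ p) b ≠ 0) (h0 : ∀ i c, 0 ≤ post p (b i) c)
    (h1 : ∀ i c, post p (b i) c ≤ 1) {θ : ℝ} (hθ : 1 ≤ θ)
    (hZ : k / θ ≤ ∑ c, ∏ i, (1 - post p (b i) c)) : Good (step Δ p) θ b := by
  have hk' : (2 : ℝ) ≤ k := by exact_mod_cast hk
  refine ⟨hm', fun c => ?_⟩
  rw [post_step hk b hm]
  set Z := ∑ c, ∏ i, (1 - post p (b i) c)
  have hZ0 : 0 < Z := lt_of_lt_of_le (by positivity) hZ
  have hw0 : 0 ≤ ∏ i, (1 - post p (b i) c) := prod_nonneg fun i _ => by linarith [h1 i c]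
  have hw1 : ∏ i, (1 - post p (b i) c) ≤ 1 :=
    prod_le_one (fun i _ => by linarith [h1 i c]) fun i _ => by linarith [h0 i c]
  have h2 : k * ((∏ i, (1 - post p (b i) c)) / Z) ≤ θ := by
    rw [← mul_div_assoc, div_le_iff₀ hZ0]
    rw [div_le_iff₀ (by linarith)] at hZ
    nlinarith
  -- The lower side of the deviation is free: it is at least `-1`, and `θ ≥ 1`.
  have h3 : 0 ≤ k * ((∏ i, (1 - post p (b i) c)) / Z) := by positivity
  rw [abs_le]
  constructor <;> linarith

end Deterministic

/-! ### The level above the leaves: counting unused colours -/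

section Leaf

variable {k : ℕ}

/-- The channel of a leaf, whose colour is observed. -/
def leafChannel (k : ℕ) (s b : Fin k) : ℝ := if b = s then 1 else 0

lemma isChannel_leafChannel : IsChannel (leafChannel k) where
  nonneg s b := by
    unfold leafChannel
    split_ifs <;> norm_num
  sum_eq_one s := by simp [leafChannel]

lemma isColorSymmetric_leafChannel : IsColorSymmetric (leafChannel k) :=
  fun π => ⟨π, fun j b => by simp [leafChannel]⟩

lemma mass_leafChannel (b : Fin k) : mass (leafChannel k) b = 1 := by
  simp [mass, leafChannel]

lemma post_leafChannel (b c : Fin k) : post (leafChannel k) b c = if b = c then 1 else 0 := by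
  rw [post, mass_leafChannel, div_one, leafChannel]

lemma childLik_leafChannel (s b : Fin k) :
    childLik (leafChannel k) s b = if b = s then 0 else 1 / ((k : ℝ) - 1) := by
  rw [childLik_eq, mass_leafChannel, leafChannel]
  split_ifs <;> simp

/-- The number of colours of `A` that are not used by `b`. -/
def unused {ι : Type*} [Fintype ι] (A : Finset (Fin k)) (b : ι → Fin k) : ℕ :=
  #{c ∈ A | ∀ i, b i ≠ c}

/-- A child's colour is uniform on the colours other than `s`, so it hits `A` with probability `#A /
(k - 1)`. The bound is again exponential in `#A`, with a smaller rate, and can therefore be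
iterated. -/
lemma sum_exp_neg_card_erase_le (hk : 2 ≤ k) {x lam : ℝ} (hx : 0 ≤ x) (hxl : x ≤ lam)
    (hl : lam ≤ 1) {s : Fin k} {A : Finset (Fin k)} (hA : s ∉ A) :
    ∑ j, childLik (leafChannel k) s j * Real.exp (-(x * #(A.erase j))) ≤
      Real.exp (-(x * (1 - (1 + lam) / ((k : ℝ) - 1)) * #A)) := by
  have hk' : (2 : ℝ) ≤ k := by exact_mod_cast hk
  have hk1 : (0 : ℝ) < (k : ℝ) - 1 := by linarith
  have hex : Real.exp x - 1 ≤ x * (1 + lam) := by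
    have h := le_of_abs_le (Real.abs_exp_sub_one_sub_id_le (x := x)
      (by rw [abs_of_nonneg hx]; linarith))
    nlinarith
  have h1 : ∀ j, childLik (leafChannel k) s j * Real.exp (-(x * #(A.erase j))) ≤
      Real.exp (-(x * #A)) * (childLik (leafChannel k) s j +
        if j ∈ A then (Real.exp x - 1) / ((k : ℝ) - 1) else 0) := by
    intro j
    by_cases hj : j ∈ A
    · have hjs : j ≠ s := fun h => hA (h ▸ hj)
      have hpos : 1 ≤ #A := card_pos.2 ⟨j, hj⟩
      rw [if_pos hj, childLik_leafChannel, if_neg hjs, card_erase_of_mem hj, Nat.cast_sub hpos]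
      have : Real.exp (-(x * (#A - (1 : ℕ)))) = Real.exp (-(x * #A)) * Real.exp x := by
        rw [← Real.exp_add]
        push_cast
        ring_nf
      rw [this]
      apply le_of_eq
      field_simp
      ring
    · rw [if_neg hj, erase_eq_of_notMem hj, add_zero, mul_comm]
  calc _ ≤ ∑ j, Real.exp (-(x * #A)) * (childLik (leafChannel k) s j +
        if j ∈ A then (Real.exp x - 1) / ((k : ℝ) - 1) else 0) := sum_le_sum fun j _ => h1 j
    _ = Real.exp (-(x * #A)) * (1 + #A * ((Real.exp x - 1) / ((k : ℝ) - 1))) := by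
        rw [← mul_sum, sum_add_distrib, isChannel_leafChannel.sum_childLik hk, sum_ite_mem,
          univ_inter, sum_const, nsmul_eq_mul]
    _ ≤ Real.exp (-(x * #A)) * Real.exp (#A * (x * (1 + lam) / ((k : ℝ) - 1))) := by
        gcongr
        rw [add_comm]
        refine le_trans ?_ (Real.add_one_le_exp _)
        gcongr
    _ = _ := by
        rw [← Real.exp_add]
        ring_nf

/-- Peel off the first child: if it has colour `j`, the unused colours of `A` are those of `A.erase
j` unused by the others. Each child shrinks the rate by a factor in `[0, 1]`, so the rate stays
below `lam`. -/
lemma sum_exp_neg_unused_le (hk : 3 ≤ k) {lam : ℝ} (hl : lam ≤ 1) {s : Fin k} (n : ℕ) :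
    ∀ (x : ℝ), 0 ≤ x → x ≤ lam → ∀ A : Finset (Fin k), s ∉ A →
    ∑ b : Fin n → Fin k, step n (leafChannel k) s b * Real.exp (-(x * unused A b)) ≤
      Real.exp (-(x * (1 - (1 + lam) / ((k : ℝ) - 1)) ^ n * #A)) := by
  have hk' : (3 : ℝ) ≤ k := by exact_mod_cast hk
  induction n with
  | zero =>
    intro x hx hxl A hA
    simp [step, unused]
  | succ n ih =>
    intro x hx hxl A hA
    set ρ := 1 - (1 + lam) / ((k : ℝ) - 1) with hρ
    have hρ0 : 0 ≤ ρ := by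
      rw [hρ, sub_nonneg, div_le_one (by linarith)]
      linarith
    have hρ1 : ρ ≤ 1 := by
      have : 0 ≤ (1 + lam) / ((k : ℝ) - 1) := div_nonneg (by linarith) (by linarith)
      linarith
    have hun : ∀ (j : Fin k) (b : Fin n → Fin k),
        unused A (Fin.cons j b : Fin (n + 1) → Fin k) = unused (A.erase j) b := by
      intro j b
      unfold unused
      congr 1
      ext c
      simp only [mem_filter, Fin.forall_fin_succ, Fin.cons_zero, Fin.cons_succ, mem_erase]
      tauto
    rw [← (Fin.consEquiv fun _ : Fin (n + 1) => Fin k).sum_comp, Fintype.sum_prod_type]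
    have hpow : x * ρ ^ n ≤ lam := (mul_le_of_le_one_right hx (pow_le_one₀ hρ0 hρ1)).trans hxl
    calc _ = ∑ j, childLik (leafChannel k) s j * ∑ b : Fin n → Fin k,
          step n (leafChannel k) s b * Real.exp (-(x * unused (A.erase j) b)) := by
          refine sum_congr rfl fun j _ => ?_
          rw [mul_sum]
          refine sum_congr rfl fun b _ => ?_
          have : (Fin.consEquiv fun _ : Fin (n + 1) => Fin k) (j, b) = Fin.cons j b := rfl
          rw [this, hun, step, Fin.prod_univ_succ, step]
          simp only [Fin.cons_zero, Fin.cons_succ]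
          ring
      _ ≤ ∑ j, childLik (leafChannel k) s j * Real.exp (-(x * ρ ^ n * #(A.erase j))) := by
          refine sum_le_sum fun j _ => mul_le_mul_of_nonneg_left ?_
            (isChannel_leafChannel.childLik_nonneg (by omega) s j)
          exact ih x hx hxl _ fun h => hA (mem_of_mem_erase h)
      _ ≤ _ := by
          refine (sum_exp_neg_card_erase_le (by omega) (by positivity) hpow hl hA).trans
            (le_of_eq ?_)
          rw [← hρ, pow_succ, mul_assoc x]

/-- A vertex above the leaves rarely sees few unused colours. -/
lemma prob_unused_lt_le (hk : 3 ≤ k) {lam : ℝ} (h0 : 0 ≤ lam) (hl : lam ≤ 1) (Δ : ℕ) (s : Fin k)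
    (K : ℝ) :
    prob (step Δ (leafChannel k)) s (fun b => (unused univ b : ℝ) < K) ≤
      Real.exp (lam * K - lam * (1 - (1 + lam) / ((k : ℝ) - 1)) ^ Δ * ((k : ℝ) - 1)) := by
  classical
  have hmain := sum_exp_neg_unused_le hk hl (s := s) Δ lam h0 le_rfl (univ.erase s)
    (notMem_erase s _)
  rw [card_erase_of_mem (mem_univ s), card_univ, Fintype.card_fin, Nat.cast_sub (by omega),
    Nat.cast_one] at hmain
  rw [sub_eq_add_neg, Real.exp_add]
  refine le_trans ?_ (mul_le_mul_of_nonneg_left hmain (Real.exp_pos _).le)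
  rw [prob_eq_sum_ite, mul_sum]
  refine sum_le_sum fun b _ => ?_
  have hnn := (isChannel_leafChannel.step (Δ := Δ) (by omega : 2 ≤ k)).nonneg s b
  split_ifs with h
  · rw [mul_left_comm, ← Real.exp_add]
    refine le_mul_of_one_le_right hnn (Real.one_le_exp ?_)
    have h2 : (unused (univ.erase s) b : ℝ) ≤ unused univ b := by
      unfold unused
      exact_mod_cast card_le_card (filter_subset_filter _ (subset_univ _))
    nlinarith
  · positivity

/-- Leaf posteriors are point masses, so the product is the indicator that `c` is unused. A bound on
unused colours is thus a bound on the partition function. -/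
lemma sum_prod_one_sub_post_leafChannel {Δ : ℕ} (b : Fin Δ → Fin k) :
    ∑ c, ∏ i, (1 - post (leafChannel k) (b i) c) = unused univ b := by
  unfold unused
  rw [card_filter]
  push_cast
  refine sum_congr rfl fun c _ => ?_
  simp_rw [post_leafChannel]
  split_ifs with h
  · refine prod_eq_one fun i _ => ?_
    rw [if_neg (h i), sub_zero]
  · push Not at h
    obtain ⟨i, hi⟩ := h
    exact prod_eq_zero (mem_univ i) (by rw [if_pos hi, sub_self])

end Leaf

end TreeColoring

namespace TreeColoring

open Finset

/-! ### Scale, thresholds and numerical inequalities -/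

section Parameters

variable {Δ k : ℕ} {X : ℝ}

/-- The scale `X` is a small power of `Δ`, and `k` exceeds `Δ / log Δ` by a constant factor. -/
structure Scale (Δ k : ℕ) (X : ℝ) : Prop where
  le_X : 1000 ≤ X
  log_le : 4 * Real.log Δ ≤ X
  pow_le : X ^ 64 ≤ Δ
  k_pos : 0 < k
  ratio_le : (1 + 1 / X) * (Δ / k) ≤ Real.log Δ - 24 * Real.log X

/-- The successive thresholds for the relative deviation of the posterior. -/
noncomputable def threshold (Δ : ℕ) (X : ℝ) : ℕ → ℝ
  | 0 => Δ / X ^ 16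
  | r + 1 => (X ^ (2 * (r + 1)))⁻¹

lemma threshold_succ_succ (r : ℕ) :
    threshold Δ X (r + 2) = threshold Δ X (r + 1) * (X ^ 2)⁻¹ := by
  simp only [threshold]
  rw [← mul_inv, ← pow_add]
  ring_nf

lemma exp_neg_le_half_exp_neg {a b : ℝ} (hab : a + 1 ≤ b) : Real.exp (-b) ≤ Real.exp (-a) / 2 := by
  have h1 : Real.exp (-b) ≤ Real.exp (-a) * Real.exp (-1) := by
    rw [← Real.exp_add, Real.exp_le_exp]
    linarith
  have h2 : Real.exp (-1) ≤ 1 / 2 := by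
    rw [Real.exp_neg, one_div]
    refine inv_anti₀ (by norm_num) ?_
    have := Real.add_one_le_exp 1
    linarith
  have h3 := Real.exp_pos (-a)
  nlinarith

namespace Scale

variable (h : Scale Δ k X)
include h

lemma X_pos : 0 < X := by linarith [h.le_X]

lemma Δ_pos : (0 : ℝ) < Δ := lt_of_lt_of_le (pow_pos h.X_pos _) h.pow_le

lemma k_cast_pos : (0 : ℝ) < k := by exact_mod_cast h.k_pos

lemma Δ_le : (Δ : ℝ) ≤ k * X := by
  have hX := h.X_pos
  have h1 : (Δ : ℝ) / k ≤ X := by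
    have h2 : 0 ≤ (Δ : ℝ) / k := by positivity
    have h3 : 0 ≤ 1 / X * ((Δ : ℝ) / k) := by positivity
    have h4 := h.ratio_le
    have h5 : 0 ≤ Real.log X := Real.log_nonneg (by linarith [h.le_X])
    have h6 := h.log_le
    nlinarith
  rw [div_le_iff₀ h.k_cast_pos] at h1
  linarith

lemma pow_le_k : X ^ 63 ≤ k := by
  have hX := h.X_pos
  have h1 := h.pow_le.trans h.Δ_le
  rw [pow_succ] at h1
  exact le_of_mul_le_mul_right h1 hX

lemma pow_le_pow {m n : ℕ} (hmn : m ≤ n) : X ^ m ≤ X ^ n :=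
  pow_le_pow_right₀ (by linarith [h.le_X]) hmn

lemma mul_pow_le {m n : ℕ} (hmn : m < n) : 1000 * X ^ m ≤ X ^ n := by
  refine le_trans ?_ (h.pow_le_pow hmn)
  rw [pow_succ, mul_comm]
  exact mul_le_mul_of_nonneg_left h.le_X (pow_pos h.X_pos _).le

lemma one_le_pow (n : ℕ) : 1 ≤ X ^ n := one_le_pow₀ (by linarith [h.le_X])

lemma k_large : 1000 ≤ (k : ℝ) := by
  have := h.pow_le_k
  have := h.pow_le_pow (show 1 ≤ 63 by norm_num)
  rw [pow_one] at this
  linarith [h.le_X]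

lemma three_le_k : 3 ≤ k := by
  have := h.k_large
  have : (3 : ℝ) ≤ k := by linarith
  exact_mod_cast this

lemma threshold_pos (r : ℕ) : 0 < threshold Δ X r := by
  have := h.X_pos
  have := h.Δ_pos
  cases r <;> simp only [threshold] <;> positivity

lemma threshold_succ_le (r : ℕ) : threshold Δ X (r + 1) ≤ (X ^ 2)⁻¹ := by
  simp only [threshold]
  exact inv_anti₀ (pow_pos h.X_pos _) (h.pow_le_pow (by omega))

lemma threshold_succ_le_one (r : ℕ) : threshold Δ X (r + 1) ≤ 1 / 1000 := by
  refine (h.threshold_succ_le r).trans ?_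
  rw [one_div]
  exact inv_anti₀ (by norm_num) (by nlinarith [h.le_X])

lemma one_le_threshold_zero : 1 ≤ threshold Δ X 0 := by
  simp only [threshold]
  rw [le_div_iff₀ (pow_pos h.X_pos _), one_mul]
  exact (h.pow_le_pow (by norm_num)).trans h.pow_le

lemma threshold_zero_le : threshold Δ X 0 * X ^ 15 ≤ k := by
  have hX := h.X_pos
  simp only [threshold]
  rw [div_mul_eq_mul_div, div_le_iff₀ (by positivity), pow_succ X 15]
  calc Δ * X ^ 15 ≤ k * X * X ^ 15 := by
        gcongr
        exact h.Δ_le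
    _ = _ := by ring

lemma threshold_le (r : ℕ) : threshold Δ X r ≤ (k : ℝ) / 1000 := by
  cases r with
  | zero =>
    have h1 := h.threshold_zero_le
    have h3 := h.pow_le_pow (show 1 ≤ 15 by norm_num)
    have := h.le_X
    rw [pow_one] at h3
    nlinarith
  | succ r =>
    have := h.threshold_succ_le_one r
    have := h.k_large
    linarith

/-- Up to `X ^ 8` exceptional children, each with deviation up to the previous threshold, are
negligible in the target sum. -/
lemma mul_threshold_le (r : ℕ) : X ^ 8 * threshold Δ X r ≤ k * threshold Δ X (r + 1) / X := by
  have hX := h.X_pos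
  rw [le_div_iff₀ hX]
  cases r with
  | zero =>
    have h1 := h.threshold_zero_le
    have h2 := h.threshold_pos 0
    have h3 : threshold Δ X 1 = (X ^ 2)⁻¹ := by simp [threshold]
    rw [zero_add, h3, ← div_eq_mul_inv, le_div_iff₀ (by positivity)]
    calc X ^ 8 * threshold Δ X 0 * X * X ^ 2 = threshold Δ X 0 * X ^ 11 := by ring
      _ ≤ threshold Δ X 0 * X ^ 15 := by
          exact mul_le_mul_of_nonneg_left (h.pow_le_pow (by norm_num)) h2.le
      _ ≤ k := h1
  | succ r =>
    have h2 := h.threshold_pos (r + 1)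
    rw [threshold_succ_succ, ← mul_assoc, ← div_eq_mul_inv, le_div_iff₀ (by positivity)]
    calc X ^ 8 * threshold Δ X (r + 1) * X * X ^ 2 = X ^ 11 * threshold Δ X (r + 1) := by ring
      _ ≤ X ^ 63 * threshold Δ X (r + 1) := by
          exact mul_le_mul_of_nonneg_right (h.pow_le_pow (by norm_num)) h2.le
      _ ≤ _ := by
          gcongr
          exact h.pow_le_k

/-- The companion bound for the typical children: even without cancellation, being one threshold
ahead of the target makes their total negligible. -/
lemma Δ_mul_threshold_le (r : ℕ) :
    Δ * threshold Δ X (r + 2) ≤ k * threshold Δ X (r + 1) / X := by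
  have hX := h.X_pos
  have h2 := h.threshold_pos (r + 1)
  rw [threshold_succ_succ, le_div_iff₀ hX, ← mul_assoc]
  have h3 : Δ * threshold Δ X (r + 1) * (X ^ 2)⁻¹ * X = Δ * threshold Δ X (r + 1) / X := by
    field_simp
  rw [h3, div_le_iff₀ hX]
  calc _ ≤ k * X * threshold Δ X (r + 1) := by
        gcongr
        exact h.Δ_le
    _ = _ := by ring

/-- The exponentiated form of `ratio_le`: a colour survives with probability at least `X ^ 24 / Δ`,
even after inflating the exponent by `1 + 1 / X` to absorb errors. -/
lemma exp_neg_ratio_ge : X ^ 24 / Δ ≤ Real.exp (-((1 + 1 / X) * (Δ / k))) := by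
  have hX := h.X_pos
  have hΔ := h.Δ_pos
  have h1 : X ^ 24 / Δ = Real.exp (-(Real.log Δ - 24 * Real.log X)) := by
    rw [neg_sub, Real.exp_sub, Real.exp_log hΔ]
    congr 1
    rw [show (24 : ℝ) = ((24 : ℕ) : ℝ) by norm_num, Real.exp_nat_mul, Real.exp_log hX]
  rw [h1]
  exact Real.exp_le_exp.2 (neg_le_neg h.ratio_le)

lemma le_partition_bound {x : ℝ} (hx0 : 0 ≤ x) (hx : x * X ≤ 1 / 10) :
    k / threshold Δ X 0 ≤
      (k - X ^ 8) * Real.exp (-((Δ / (1 - x) + 2 * X ^ 8) / (k - X ^ 8))) := by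
  have hX1 := h.le_X
  have hΔ := h.Δ_pos
  have hk := h.k_cast_pos
  have hkk := h.pow_le_k
  have hdX : 1 / (10 * X) * X = 1 / 10 := by field_simp
  -- All corrections, from `x` and from the `X ^ 8` exceptional children, are relative errors of
  -- order `d`. Together they stay below the slack `1 / X = 10 * d`.
  set d := 1 / (10 * X) with hd
  have hd1 : d ≤ 1 / 10000 := by nlinarith
  have hxd : x ≤ d := by
    by_contra hcon
    nlinarith
  have hm : X ^ 8 ≤ d * k := by
    have h1 : 1000 * X ^ 9 ≤ k := by
      have := h.mul_pow_le (show 9 < 10 by norm_num)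
      have := h.pow_le_pow (show 10 ≤ 63 by norm_num)
      linarith
    have h2 : X ^ 9 = X ^ 8 * X := pow_succ X 8
    have h3 : d * k = k / (10 * X) := by
      rw [hd]
      ring
    rw [h3, le_div_iff₀ (by positivity)]
    nlinarith
  have hm2 : 2 * X ^ 8 ≤ d * Δ := by
    have h1 : 1000 * X ^ 9 ≤ Δ := by
      have := h.mul_pow_le (show 9 < 10 by norm_num)
      have := h.pow_le_pow (show 10 ≤ 64 by norm_num)
      linarith [h.pow_le]
    have h2 : X ^ 9 = X ^ 8 * X := pow_succ X 8
    have h3 : d * Δ = Δ / (10 * X) := by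
      rw [hd]
      ring
    rw [h3, le_div_iff₀ (by positivity)]
    nlinarith
  have hkm : 0 < k - X ^ 8 := by nlinarith
  have hexp : (Δ / (1 - x) + 2 * X ^ 8) / (k - X ^ 8) ≤ (1 + 1 / X) * (Δ / k) := by
    rw [div_le_iff₀ hkm]
    have h1 : Δ / (1 - x) ≤ Δ * (1 + 2 * d) := by
      rw [div_le_iff₀ (by linarith), mul_assoc]
      refine le_mul_of_one_le_right hΔ.le ?_
      nlinarith
    have h2 : Δ * (1 - d) ≤ Δ / k * (k - X ^ 8) := by
      rw [div_mul_eq_mul_div, le_div_iff₀ hk, mul_assoc]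
      gcongr
      linarith
    have h3 : 1 / X = 10 * d := by
      rw [hd]
      field_simp
    rw [h3, mul_assoc]
    calc _ ≤ Δ * (1 + 2 * d) + d * Δ := by linarith
      _ = Δ * (1 + 3 * d) := by ring
      _ ≤ Δ * ((1 + 10 * d) * (1 - d)) := by
          gcongr
          nlinarith
      _ = (1 + 10 * d) * (Δ * (1 - d)) := by ring
      _ ≤ _ := by gcongr
  calc k / threshold Δ X 0 = k * (X ^ 16 / Δ) := by
        simp only [threshold]
        field_simp
    _ ≤ k / 2 * (X ^ 24 / Δ) := by
        rw [div_mul_eq_mul_div, le_div_iff₀ (by norm_num), mul_assoc, div_mul_eq_mul_div]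
        refine mul_le_mul_of_nonneg_left ?_ hk.le
        refine div_le_div_of_nonneg_right ?_ hΔ.le
        have := h.mul_pow_le (show 16 < 17 by norm_num)
        have := h.pow_le_pow (show 17 ≤ 24 by norm_num)
        have : 0 < X ^ 16 := by positivity
        linarith
    _ ≤ (k - X ^ 8) * Real.exp (-((1 + 1 / X) * (Δ / k))) := by
        gcongr
        · nlinarith
        · exact h.exp_neg_ratio_ge
    _ ≤ _ := by gcongr

/-- The exponent of `prob_unused_lt_le` at rate `X ^ (-2)`. The main term is at least of order `X ^
24 * k / Δ`, against a target count of `X ^ 16 * k / Δ`; the gap still gives `X` because `k * X ≥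
Δ`. -/
lemma unused_bound :
    (X ^ 2)⁻¹ * (k / threshold Δ X 0) -
      (X ^ 2)⁻¹ * (1 - (1 + (X ^ 2)⁻¹) / ((k : ℝ) - 1)) ^ Δ * ((k : ℝ) - 1) ≤ -X := by
  have hX := h.X_pos
  have hX1 := h.le_X
  have hΔ := h.Δ_pos
  have hk := h.k_cast_pos
  have hk1 := h.k_large
  have hinv : (X ^ 2)⁻¹ * X ^ 2 = 1 := by field_simp
  have hi0 : 0 < (X ^ 2)⁻¹ := by positivity
  have hi1 : (X ^ 2)⁻¹ ≤ 1 / 1000 := by nlinarith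
  set l := (X ^ 2)⁻¹ with hl
  set y := (1 + l) / ((k : ℝ) - 1) with hy
  have hy0 : 0 ≤ y := div_nonneg (by linarith) (by linarith)
  have hy1 : y < 1 := by
    rw [hy, div_lt_one (by linarith)]
    linarith
  have hρ : X ^ 24 / Δ ≤ (1 - y) ^ Δ := by
    refine h.exp_neg_ratio_ge.trans ?_
    have h1 : y / (1 - y) ≤ (1 + 1 / X) / k := by
      have h2 : y / (1 - y) = (1 + l) / ((k : ℝ) - 2 - l) := by
        rw [hy]
        have : (k : ℝ) - 1 ≠ 0 := by linarith
        have : (k : ℝ) - 2 - l ≠ 0 := by linarith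
        have : (k : ℝ) - 1 - (1 + l) ≠ 0 := by linarith
        field_simp
        ring
      rw [h2, div_le_div_iff₀ (by linarith) hk]
      have h3 : 1 / X = l * X := by
        rw [hl]
        field_simp
      have h4 : 1000 * l ≤ l * X := by nlinarith
      have h5 : l * X ≤ 1 := by
        rw [← h3, div_le_one hX]
        linarith
      have h6 : 1000 ≤ l * X * k := by
        have h7 := h.pow_le_k
        have h8 := h.pow_le_pow (show 2 ≤ 63 by norm_num)
        have h9 : X ≤ l * X * k := by
          calc X = l * X * X ^ 2 := by
                rw [mul_right_comm, hinv, one_mul]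
            _ ≤ l * X * k := by
                gcongr
                linarith
        linarith
      rw [h3]
      nlinarith
    calc Real.exp (-((1 + 1 / X) * (Δ / k))) ≤ Real.exp (-(Δ * (y / (1 - y)))) := by
          rw [Real.exp_le_exp, neg_le_neg_iff]
          calc Δ * (y / (1 - y)) ≤ Δ * ((1 + 1 / X) / k) := by gcongr
            _ = _ := by ring
      _ = (Real.exp (-(y / (1 - y)))) ^ Δ := by
          rw [← Real.exp_nat_mul]
          ring_nf
      _ ≤ _ := by
          gcongr
          exact exp_neg_div_le_one_sub hy0 le_rfl hy1
  have h1 : X ^ 24 / Δ * (k / 2) ≤ (1 - y) ^ Δ * ((k : ℝ) - 1) := by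
    have : 0 ≤ 1 - y := by linarith
    gcongr
    linarith
  have h2 : k / threshold Δ X 0 = X ^ 16 * (k / Δ) := by
    simp only [threshold]
    field_simp
  have h3 : 1 ≤ k / Δ * X := by
    rw [div_mul_eq_mul_div, le_div_iff₀ hΔ, one_mul]
    exact h.Δ_le
  have hz : (0 : ℝ) < k / Δ := by positivity
  have h4 : 4 * X ^ 16 ≤ X ^ 24 := by
    have := h.mul_pow_le (show 16 < 17 by norm_num)
    have := h.pow_le_pow (show 17 ≤ 24 by norm_num)
    have : 0 < X ^ 16 := by positivity
    linarith
  rw [h2, mul_assoc]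
  calc l * (X ^ 16 * (k / Δ)) - l * ((1 - y) ^ Δ * ((k : ℝ) - 1))
      ≤ l * (X ^ 16 * (k / Δ)) - l * (X ^ 24 / Δ * (k / 2)) := by gcongr
    _ = l * (k / Δ) * (X ^ 16 - X ^ 24 / 2) := by ring
    _ ≤ l * (k / Δ) * (-(X ^ 16)) := by
        gcongr
        linarith
    _ = -((k / Δ * X) * X ^ 12 * X * (l * X ^ 2)) := by ring
    _ = -((k / Δ * X) * X ^ 12 * X) := by rw [hinv, mul_one]
    _ ≤ -(1 * 1 * X) := by
        gcongr
        exact h.one_le_pow 12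
    _ = -X := by ring

lemma Δ_mul_exp_le {x : ℝ} (hx : X ≤ x) : Δ * Real.exp (-(x / 2)) ≤ 1 := by
  have h1 := h.log_le
  calc Δ * Real.exp (-(x / 2)) = Real.exp (Real.log Δ - x / 2) := by
        rw [sub_eq_add_neg, Real.exp_add, Real.exp_log h.Δ_pos]
    _ ≤ 1 := by
        rw [Real.exp_le_one_iff]
        have := h.X_pos
        linarith

/-- The union bound over the colours is absorbed by the concentration exponent. -/
lemma union_bound {n : ℕ} (hn : n ≤ 3) :
    2 * k * Real.exp (-(k / Δ * X ^ 10 / 128)) ≤ Real.exp (-X ^ n) / 2 := by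
  have hX := h.X_pos
  have hΔ := h.Δ_pos
  have hk := h.k_cast_pos
  set z := (k : ℝ) / Δ with hz
  have hz0 : 0 < z := by positivity
  have hz1 : 1 ≤ z * X := by
    rw [hz, div_mul_eq_mul_div, le_div_iff₀ hΔ, one_mul]
    exact h.Δ_le
  -- There is no upper bound on `k` in terms of `Δ`, so the union bound over colours must be paid by
  -- an exponent proportional to `z = k / Δ`.
  have hkz : (k : ℝ) ≤ Real.exp (z + X) := by
    have h1 : (k : ℝ) = z * Δ := by
      rw [hz]
      field_simp
    rw [h1, Real.exp_add]
    have h2 : z ≤ Real.exp z := by linarith [Real.add_one_le_exp z]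
    have h3 : (Δ : ℝ) ≤ Real.exp X := by
      rw [← Real.log_le_iff_le_exp hΔ]
      have := h.log_le
      linarith
    gcongr
  have h2 : (2 : ℝ) ≤ Real.exp 1 := by linarith [Real.add_one_le_exp 1]
  calc 2 * k * Real.exp (-(z * X ^ 10 / 128))
      ≤ Real.exp 1 * Real.exp (z + X) * Real.exp (-(z * X ^ 10 / 128)) := by gcongr
    _ = Real.exp (-(z * X ^ 10 / 128 - 1 - z - X)) := by
        rw [← Real.exp_add, ← Real.exp_add]
        ring_nf
    _ ≤ _ := by
        refine exp_neg_le_half_exp_neg ?_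
        have e0 := h.pow_le_pow hn
        have e1 := h.mul_pow_le (show 3 < 4 by norm_num)
        have e2 := h.one_le_pow 3
        have e3 : X ≤ X ^ 3 := by simpa using h.pow_le_pow (show 1 ≤ 3 by norm_num)
        have e4 := h.pow_le_pow (show 4 ≤ 9 by norm_num)
        have e5 : X ^ 9 ≤ z * X ^ 10 := by
          calc X ^ 9 = 1 * X ^ 9 := by ring
            _ ≤ z * X * X ^ 9 := by gcongr
            _ = _ := by ring
        have e6 : z * 1000 ≤ z * X ^ 10 := by
          have := h.mul_pow_le (show 9 < 10 by norm_num)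
          have := h.one_le_pow 9
          gcongr
          linarith
        linarith

lemma concentration_exponent_succ (r : ℕ) :
    ∃ lam : ℝ, 0 ≤ lam ∧ lam * threshold Δ X (r + 1) ≤ 1 ∧
      -(lam * (k * threshold Δ X (r + 2) / 64)) +
        Δ * (lam * threshold Δ X (r + 1) / ((k : ℝ) - 1) +
          lam ^ 2 * threshold Δ X (r + 1) ^ 2) ≤ -(k / Δ * X ^ 10 / 128) := by
  have hX := h.X_pos
  have hX1 := h.le_X
  have hΔ := h.Δ_pos
  have hk := h.k_cast_pos
  have hθ := h.threshold_pos (r + 1)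
  rw [threshold_succ_succ]
  set θ := threshold Δ X (r + 1)
  -- The gain is `k * X ^ (-6) / 64`. The bias and variance terms each lose at most `k * X ^ (-6) /
  -- 1000`, the variance term being `Δ * X ^ (-8)`.
  refine ⟨(X ^ 4)⁻¹ / θ, by positivity, ?_, ?_⟩
  · rw [div_mul_cancel₀ _ hθ.ne']
    exact inv_le_one_of_one_le₀ (h.one_le_pow 4)
  · have hk2 : (k : ℝ) / 2 ≤ k - 1 := by linarith [h.k_large]
    have e1 : (X ^ 4)⁻¹ / θ * (k * (θ * (X ^ 2)⁻¹) / 64) = k * (X ^ 6)⁻¹ / 64 := by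
      field_simp
    have e2 : (X ^ 4)⁻¹ / θ * θ = (X ^ 4)⁻¹ := div_mul_cancel₀ _ hθ.ne'
    have e3 : ((X ^ 4)⁻¹ / θ) ^ 2 * θ ^ 2 = (X ^ 8)⁻¹ := by
      field_simp
    rw [e1, e2, e3]
    have h1 : (X ^ 4)⁻¹ / ((k : ℝ) - 1) ≤ (X ^ 4)⁻¹ / (k / 2) := by gcongr
    have h2 : Δ * ((X ^ 4)⁻¹ / (k / 2)) ≤ k * (X ^ 6)⁻¹ / 1000 := by
      rw [div_div_eq_mul_div, ← mul_div_assoc, div_le_iff₀ hk]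
      calc Δ * ((X ^ 4)⁻¹ * 2) ≤ k * X * ((X ^ 4)⁻¹ * 2) := by
            gcongr
            exact h.Δ_le
        _ = k * (X ^ 6)⁻¹ * (2 * X ^ 3) := by field_simp
        _ ≤ k * (X ^ 6)⁻¹ * (k / 1000) := by
            gcongr
            have := h.mul_pow_le (show 3 < 4 by norm_num)
            have := h.mul_pow_le (show 4 < 5 by norm_num)
            have := h.pow_le_pow (show 5 ≤ 63 by norm_num)
            have := h.pow_le_k
            have : 0 < X ^ 3 := by positivity
            linarith
        _ = _ := by ring
    have h3 : Δ * (X ^ 8)⁻¹ ≤ k * (X ^ 6)⁻¹ / 1000 := by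
      calc Δ * (X ^ 8)⁻¹ ≤ k * X * (X ^ 8)⁻¹ := by
            gcongr
            exact h.Δ_le
        _ = k * (X ^ 6)⁻¹ * (1 / X) := by field_simp
        _ ≤ k * (X ^ 6)⁻¹ * (1 / 1000) := by gcongr
        _ = _ := by ring
    have h4 : (k : ℝ) / Δ * X ^ 10 ≤ k * (X ^ 6)⁻¹ := by
      rw [div_mul_eq_mul_div, div_le_iff₀ hΔ, mul_assoc]
      gcongr
      rw [inv_mul_eq_div, le_div_iff₀ (by positivity), ← pow_add]
      exact (h.pow_le_pow (by norm_num)).trans h.pow_le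
    have h5 : 0 < k * (X ^ 6)⁻¹ := by positivity
    rw [mul_add]
    have h6 : Δ * ((X ^ 4)⁻¹ / ((k : ℝ) - 1)) ≤ Δ * ((X ^ 4)⁻¹ / (k / 2)) := by gcongr
    linarith

lemma concentration_exponent_zero :
    ∃ lam : ℝ, 0 ≤ lam ∧ lam * threshold Δ X 0 ≤ 1 ∧
      -(lam * (k * threshold Δ X 1 / 64)) +
        Δ * (lam * threshold Δ X 0 / ((k : ℝ) - 1) +
          lam ^ 2 * (3 * threshold Δ X 0)) ≤ -(k / Δ * X ^ 10 / 128) := by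
  have hX := h.X_pos
  have hX1 := h.le_X
  have hΔ := h.Δ_pos
  have hk := h.k_cast_pos
  have hk2 : (k : ℝ) / 2 ≤ k - 1 := by linarith [h.k_large]
  have hθ1 : threshold Δ X 1 = (X ^ 2)⁻¹ := by simp [threshold]
  have hθ0 : threshold Δ X 0 = Δ / X ^ 16 := rfl
  rw [hθ1, hθ0]
  -- With the variance bound linear in the threshold, the gain is `k / Δ * X ^ 10 / 64`, at least `X
  -- ^ 9 / 64`. The variance costs only `3 * X ^ 8` and the bias at most 1.
  refine ⟨X ^ 12 / Δ, by positivity, ?_, ?_⟩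
  · have : X ^ 12 / Δ * (Δ / X ^ 16) = (X ^ 4)⁻¹ := by field_simp
    rw [this]
    exact inv_le_one_of_one_le₀ (h.one_le_pow 4)
  · have e1 : X ^ 12 / Δ * (k * (X ^ 2)⁻¹ / 64) = k / Δ * X ^ 10 / 64 := by
      field_simp
    have e2 : X ^ 12 / Δ * (Δ / X ^ 16) = (X ^ 4)⁻¹ := by field_simp
    have e3 : Δ * ((X ^ 12 / Δ) ^ 2 * (3 * (Δ / X ^ 16))) = 3 * X ^ 8 := by
      field_simp
    rw [mul_add, e1, e2, e3]
    have h1 : Δ * ((X ^ 4)⁻¹ / ((k : ℝ) - 1)) ≤ 1 := by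
      calc Δ * ((X ^ 4)⁻¹ / ((k : ℝ) - 1)) ≤ k * X * ((X ^ 4)⁻¹ / (k / 2)) := by
            refine mul_le_mul h.Δ_le ?_ (div_nonneg (by positivity) (by linarith)) (by positivity)
            gcongr
        _ = 2 / X ^ 3 := by field_simp
        _ ≤ 1 := by
            rw [div_le_one (by positivity)]
            have := h.mul_pow_le (show 2 < 3 by norm_num)
            have := h.one_le_pow 2
            linarith
    have h2 : X ^ 9 ≤ k / Δ * X ^ 10 := by
      have h3 : 1 ≤ k / Δ * X := by
        rw [div_mul_eq_mul_div, le_div_iff₀ hΔ, one_mul]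
        exact h.Δ_le
      calc X ^ 9 = 1 * X ^ 9 := by ring
        _ ≤ k / Δ * X * X ^ 9 := by gcongr
        _ = _ := by ring
    have h4 := h.mul_pow_le (show 8 < 9 by norm_num)
    have h5 := h.one_le_pow 8
    linarith

end Scale

end Parameters

end TreeColoring

namespace TreeColoring

open Finset

/-! ### Propagating the deviation bounds through one level -/

section Recursion

variable {β : Type*} {Δ k : ℕ} {X : ℝ} {p : Fin k → β → ℝ}

open Classical in
lemma Scale.good_step_of_card_le (h : Scale Δ k X) {r : ℕ} {b : Fin Δ → β}
    (hm' : mass (step Δ p) b ≠ 0) (hgood : ∀ i, Good p (threshold Δ X r) (b i))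
    (hcard : (#{i | ¬ Good p (threshold Δ X (r + 2)) (b i)} : ℝ) ≤ X ^ 8) :
    Good (step Δ p) (threshold Δ X (r + 1)) b := by
  have hX1 := h.le_X
  have hk1 := h.k_large
  have hθ := h.threshold_pos r
  have hθ' := h.threshold_pos (r + 1)
  have hθ'' := h.threshold_pos (r + 2)
  have hθ1 := h.threshold_succ_le_one r
  have h4 : threshold Δ X (r + 1) = 4 * (threshold Δ X (r + 1) / 4) := by ring
  rw [h4]
  refine good_step_of_sum_abs_le (by linarith [h.three_le_k]) (fun i => (hgood i).1) hm'
    (by linarith) (fun i c => ((hgood i).2 c).trans ?_) fun c => ?_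
  · have := h.threshold_le r
    linarith
  · have hsum : ∑ i, |(k : ℝ) * post p (b i) c - 1| ≤
        X ^ 8 * threshold Δ X r + Δ * threshold Δ X (r + 2) := by
      calc _ ≤ ∑ i, ((if ¬ Good p (threshold Δ X (r + 2)) (b i) then threshold Δ X r else 0) +
            threshold Δ X (r + 2)) := by
            refine sum_le_sum fun i _ => ?_
            split_ifs with hi
            · linarith [hi.2 c]
            · linarith [(hgood i).2 c]
        _ = #{i | ¬ Good p (threshold Δ X (r + 2)) (b i)} * threshold Δ X r +
            Δ * threshold Δ X (r + 2) := by
            rw [sum_add_distrib, ← sum_filter, sum_const, sum_const, card_univ, Fintype.card_fin,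
              nsmul_eq_mul, nsmul_eq_mul]
        _ ≤ _ := by gcongr
    have h1 := h.mul_threshold_le r
    have h2 := h.Δ_mul_threshold_le r
    have h3 : k * threshold Δ X (r + 1) / X ≤ k * threshold Δ X (r + 1) / 1000 := by gcongr
    have h5 : 0 < k * threshold Δ X (r + 1) := by positivity
    linarith

variable [Fintype β]

lemma Scale.prob_leaf_step (h : Scale Δ k X) (s : Fin k) :
    prob (step Δ (leafChannel k)) s
      (fun b => ¬ Good (step Δ (leafChannel k)) (threshold Δ X 0) b) ≤ Real.exp (-X) := by
  have hk := h.three_le_k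
  have hl : (X ^ 2)⁻¹ ≤ 1 := inv_le_one_of_one_le₀ (h.one_le_pow 2)
  have hstep := isChannel_leafChannel.step (Δ := Δ) (by omega : 2 ≤ k)
  refine le_trans ?_ ((prob_unused_lt_le hk (by positivity) hl Δ s
    (k / threshold Δ X 0)).trans (Real.exp_le_exp.2 h.unused_bound))
  refine hstep.prob_le fun b hb hbad => ?_
  by_contra hcon
  rw [not_lt, ← sum_prod_one_sub_post_leafChannel] at hcon
  refine hbad (good_step_of_le_partition (by omega)
    (fun i => isChannel_leafChannel.mass_child_ne_zero hb i) (hstep.mass_ne_zero hb)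
    (fun i c => ?_) (fun i c => ?_) h.one_le_threshold_zero hcon) <;>
  · rw [post_leafChannel]
    split_ifs <;> norm_num

/-- Failure requires at least `X ^ 8` failed children, which multiplies the exponent by `X ^ 8 / 2`
up to an additive constant, more than the factor `X` claimed. -/
lemma Scale.prob_step_zero (h : Scale Δ k X) (hp : IsChannel p) {n : ℕ} (hn : 1 ≤ n)
    (hq : ∀ s, prob p s (fun b => ¬ Good p (threshold Δ X 0) b) ≤ Real.exp (-X ^ n))
    (s : Fin k) :
    prob (step Δ p) s (fun b => ¬ Good (step Δ p) (threshold Δ X 0) b) ≤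
      Real.exp (-X ^ (n + 1)) := by
  classical
  have hk := h.three_le_k
  have hX := h.X_pos
  have hX1 := h.le_X
  have hk0 := h.k_cast_pos
  have hstep := hp.step (Δ := Δ) (by omega : 2 ≤ k)
  have hXn : X ≤ X ^ n := by simpa using h.pow_le_pow hn
  have hθ1 := h.one_le_threshold_zero
  refine le_trans (hstep.prob_le fun b hb hbad => ?_) ((hp.prob_step_card_le (by omega)
    (pow_pos hX n).le hq (h.Δ_mul_exp_le hXn) s (X ^ 8)).trans (Real.exp_le_exp.2 ?_))
  · by_contra hcon
    rw [not_le] at hcon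
    have hm := fun i => hp.mass_child_ne_zero hb i
    have hpost0 : ∀ i c, 0 ≤ post p (b i) c := fun i c => hp.post_nonneg (b i) c
    have hpost1 : ∀ i c, post p (b i) c ≤ 1 := fun i c => by
      rw [← sum_post (hm i)]
      exact single_le_sum (f := post p (b i)) (fun c _ => hpost0 i c) (mem_univ c)
    refine hbad (good_step_of_le_partition (by omega) hm (hstep.mass_ne_zero hb)
      hpost0 hpost1 hθ1 ?_)
    -- A good child has posterior at most `(1 + θ) / k`, hence at most `2 * θ / k` because the
    -- zeroth threshold `θ` is at least 1.
    set x := 2 * threshold Δ X 0 / k with hx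
    have hx0 : 0 ≤ x := by positivity
    have hxX : x * X ≤ 1 / 10 := by
      rw [hx, div_mul_eq_mul_div, div_le_iff₀ hk0]
      have h1 := h.threshold_zero_le
      have h2 : 1000 * X ^ 1 ≤ X ^ 15 := h.mul_pow_le (by norm_num)
      have h3 := h.threshold_pos 0
      nlinarith
    refine (h.le_partition_bound hx0 hxX).trans ?_
    refine le_sum_prod_one_sub (η := fun i => post p (b i)) (m := X ^ 8) hpost0
      (fun i => sum_post (hm i))
      (S := {i | ¬ Good p (threshold Δ X 0) (b i)}) hcon.le ?_ ?_ fun i hi c => ?_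
    · have h1 : 1000 * X ^ 8 ≤ X ^ 63 := h.mul_pow_le (by norm_num)
      have h2 := h.pow_le_k
      have h3 : 0 < X ^ 8 := by positivity
      linarith
    · nlinarith
    · simp only [mem_filter, mem_univ, true_and, not_not] at hi
      have h1 := le_of_abs_le (hi.2 c)
      rw [hx, le_div_iff₀ hk0]
      linarith
  · have h1 : X ^ (n + 1) = X ^ n * X := pow_succ X n
    have h2 : 1000 * X ^ 1 ≤ X ^ 8 := h.mul_pow_le (by norm_num)
    rw [h1]
    nlinarith

lemma sum_sq_le_of_abs_le {ι : Type*} [Fintype ι] {y : ι → ℝ} {θ : ℝ} (hy : ∀ i, |y i| ≤ θ) :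
    ∑ i, y i ^ 2 ≤ Fintype.card ι * θ ^ 2 := by
  calc ∑ i, y i ^ 2 ≤ ∑ _i : ι, θ ^ 2 := sum_le_sum fun i _ =>
        sq_le_sq' (neg_le_of_abs_le (hy i)) (le_of_abs_le (hy i))
    _ = _ := by simp

/-- From `y ≥ -1` one gets `|y| ≤ 2 + y`, so the bound is linear in `θ`; for the huge zeroth
threshold a bound by `θ ^ 2` would be too weak. -/
lemma sum_sq_le_of_neg_one_le {ι : Type*} [Fintype ι] {y : ι → ℝ} {θ : ℝ} (hθ : 0 ≤ θ)
    (hy : ∀ i, |y i| ≤ θ) (hy1 : ∀ i, -1 ≤ y i) :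
    ∑ i, y i ^ 2 ≤ θ * (2 * Fintype.card ι + |∑ i, y i|) := by
  calc ∑ i, y i ^ 2 ≤ ∑ i, θ * (2 + y i) := by
        refine sum_le_sum fun i _ => ?_
        rw [← sq_abs, sq]
        refine mul_le_mul (hy i) ?_ (abs_nonneg _) hθ
        rw [abs_le]
        constructor <;> linarith [hy1 i]
    _ = θ * (2 * Fintype.card ι + ∑ i, y i) := by
        rw [← mul_sum, sum_add_distrib]
        simp [mul_comm]
    _ ≤ _ := by
        gcongr
        exact le_abs_self _

/-- The quadratic error is negligible when the linear one is. -/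
lemma Scale.sum_sq_le (h : Scale Δ k X) (r : ℕ) {y : Fin Δ → ℝ}
    (hy : ∀ i, |y i| ≤ threshold Δ X r) (hy1 : ∀ i, -1 ≤ y i)
    (ht : |∑ i, y i| ≤ k * threshold Δ X (r + 1) / 64) :
    8 * ∑ i, y i ^ 2 ≤ threshold Δ X (r + 1) / 8 * (k : ℝ) ^ 2 := by
  have hX1 := h.le_X
  have hΔ := h.Δ_le
  cases r with
  | zero =>
    have h1 := sum_sq_le_of_neg_one_le (h.threshold_pos 0).le hy hy1
    rw [Fintype.card_fin] at h1
    have h2 := h.threshold_succ_le_one 0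
    have hθ0 := h.threshold_pos 0
    have h3 : threshold Δ X 0 * (2 * Δ + |∑ i, y i|) ≤ threshold Δ X 0 * (3 * (k * X)) := by
      gcongr
      rw [zero_add] at *
      nlinarith
    have h4 : threshold Δ X (0 + 1) = (X ^ 2)⁻¹ := by simp [threshold]
    have h5 := h.threshold_zero_le
    rw [h4]
    have h6 : threshold Δ X 0 * X * 192 * X ^ 2 ≤ k := by
      calc threshold Δ X 0 * X * 192 * X ^ 2 = threshold Δ X 0 * (192 * X ^ 3) := by ring
        _ ≤ threshold Δ X 0 * X ^ 15 := by
            have : 1000 * X ^ 3 ≤ X ^ 15 := h.mul_pow_le (by norm_num)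
            have : 0 < X ^ 3 := by positivity
            refine mul_le_mul_of_nonneg_left ?_ hθ0.le
            linarith
        _ ≤ k := h5
    have h7 : threshold Δ X 0 * X * 192 ≤ (X ^ 2)⁻¹ * k := by
      rw [inv_mul_eq_div, le_div_iff₀ (by positivity)]
      exact h6
    calc 8 * ∑ i, y i ^ 2 ≤ 8 * (threshold Δ X 0 * (3 * (k * X))) := by linarith
      _ = threshold Δ X 0 * X * 192 * (k / 8) := by ring
      _ ≤ (X ^ 2)⁻¹ * k * (k / 8) := by gcongr
      _ = _ := by ring
  | succ r =>
    have h1 := sum_sq_le_of_abs_le hy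
    rw [Fintype.card_fin] at h1
    rw [threshold_succ_succ]
    have h2 := h.threshold_succ_le_one r
    have hθ := h.threshold_pos (r + 1)
    set θ := threshold Δ X (r + 1)
    have h3 : 64 * X ≤ (X ^ 2)⁻¹ * k := by
      rw [inv_mul_eq_div, le_div_iff₀ (by positivity)]
      have e1 : 1000 * X ^ 3 ≤ X ^ 63 := h.mul_pow_le (by norm_num)
      have e2 := h.pow_le_k
      calc 64 * X * X ^ 2 = 64 * X ^ 3 := by ring
        _ ≤ (k : ℝ) := by linarith
    calc 8 * ∑ i, y i ^ 2 ≤ 8 * (Δ * θ ^ 2) := by linarith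
      _ ≤ 8 * (k * X * (θ * 1)) := by
          rw [sq]
          gcongr
          linarith
      _ = 64 * X * (θ * k / 8) := by ring
      _ ≤ (X ^ 2)⁻¹ * k * (θ * k / 8) := by gcongr
      _ = _ := by ring

lemma Scale.good_step_succ (h : Scale Δ k X) (hp : IsChannel p) {r : ℕ} {b : Fin Δ → β}
    (hm' : mass (step Δ p) b ≠ 0) (hgood : ∀ i, Good p (threshold Δ X r) (b i))
    (ht : ∀ c, |∑ i, truncDev p (threshold Δ X r) c (b i)| ≤
      k * threshold Δ X (r + 1) / 64) : Good (step Δ p) (threshold Δ X (r + 1)) b := by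
  have hk1 := h.k_large
  have hθ' := h.threshold_pos (r + 1)
  have hθ1 := h.threshold_succ_le_one r
  have h4 : threshold Δ X (r + 1) = 4 * (threshold Δ X (r + 1) / 4) := by ring
  rw [h4]
  refine good_step (by linarith [h.three_le_k]) (fun i => (hgood i).1) hm' (by linarith)
    (fun i c => ((hgood i).2 c).trans ?_) fun c => ?_
  · have := h.threshold_le r
    linarith
  · simp_rw [truncDev_of_good (hgood _)] at ht
    have hsq := h.sum_sq_le r (fun i => (hgood i).2 c) (fun i => by
      have := hp.post_nonneg (b i) c
      have : 0 ≤ k * post p (b i) c := by positivity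
      linarith) (ht c)
    have hk2 : (k : ℝ) / 2 ≤ k - 1 := by linarith
    -- The linear part contributes `1 / 32` and the quadratic part `1 / 8` of the threshold, within
    -- the `1 / 4` left by the factor 4 in `good_step`.
    calc _ ≤ k * threshold Δ X (r + 1) / 64 / (k / 2) +
          2 * (∑ i, ((k : ℝ) * post p (b i) c - 1) ^ 2) / (k / 2) ^ 2 := by
          gcongr
          exact ht c
      _ = threshold Δ X (r + 1) / 32 +
          8 * (∑ i, ((k : ℝ) * post p (b i) c - 1) ^ 2) / k ^ 2 := by
          field_simp
          ring
      _ ≤ threshold Δ X (r + 1) / 32 + threshold Δ X (r + 1) / 8 := by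
          refine add_le_add_right ?_ _
          rw [div_le_iff₀ (by positivity)]
          exact hsq
      _ ≤ _ := by linarith

lemma Scale.prob_truncDev_le (h : Scale Δ k X) (hp : IsChannel p) (hs : IsColorSymmetric p)
    (r : ℕ) (s : Fin k) :
    prob (step Δ p) s (fun b => ∃ c, k * threshold Δ X (r + 1) / 64 ≤
      |∑ i, truncDev p (threshold Δ X r) c (b i)|) ≤
      2 * k * Real.exp (-(k / Δ * X ^ 10 / 128)) := by
  have hk := h.three_le_k
  cases r with
  | zero =>
    obtain ⟨lam, h0, h1, h2⟩ := h.concentration_exponent_zero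
    refine (hp.prob_step_truncDev_le hs (by omega) (h.threshold_pos 0).le h0 h1
      (fun s c => hp.sum_childLik_mul_sq_le' (by omega) (h.threshold_pos 0).le s c) s _).trans ?_
    gcongr
  | succ r =>
    obtain ⟨lam, h0, h1, h2⟩ := h.concentration_exponent_succ r
    refine (hp.prob_step_truncDev_le hs (by omega) (h.threshold_pos (r + 1)).le h0 h1
      (fun s c => hp.sum_childLik_mul_sq_le (by omega) (h.threshold_pos (r + 1)).le s c)
      s _).trans ?_
    gcongr

/-- One power of `X` in the exponent is given up to pay for the union over the `Δ` children. -/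
lemma Scale.prob_exists_bad_le (h : Scale Δ k X) (hp : IsChannel p) {E : β → Prop} {n : ℕ}
    (hq : ∀ s, prob p s E ≤ Real.exp (-X ^ (n + 1))) (s : Fin k) :
    prob (step Δ p) s (fun b => ∃ i, E (b i)) ≤ Real.exp (-X ^ n) / 2 := by
  classical
  have hk := h.three_le_k
  have hX := h.X_pos
  have hstep := hp.step (Δ := Δ) (by omega : 2 ≤ k)
  have hXn : X ≤ X ^ (n + 1) := by simpa using h.pow_le_pow (show 1 ≤ n + 1 by omega)
  refine le_trans (hstep.prob_le fun b hb hex => ?_) (((hp.prob_step_card_le (by omega)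
    (pow_pos hX (n + 1)).le hq (h.Δ_mul_exp_le hXn) s 1).trans (le_of_eq (congrArg Real.exp
      (by ring : 1 - 1 * (X ^ (n + 1) / 2) = -(X ^ (n + 1) / 2 - 1))))).trans
      (exp_neg_le_half_exp_neg ?_))
  · obtain ⟨i, hi⟩ := hex
    have : 1 ≤ #{i | E (b i)} := card_pos.2 ⟨i, by simpa using hi⟩
    exact_mod_cast this
  · have h1 : 1000 * X ^ n ≤ X ^ (n + 1) := h.mul_pow_le (by omega)
    have h2 := h.one_le_pow n
    linarith

/-- The deviation contracts by concentration. -/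
lemma Scale.prob_step_contract (h : Scale Δ k X) (hp : IsChannel p) (hs : IsColorSymmetric p)
    {n r : ℕ} (hn : n ≤ 3)
    (hq : ∀ s, prob p s (fun b => ¬ Good p (threshold Δ X r) b) ≤ Real.exp (-X ^ (n + 1)))
    (s : Fin k) :
    prob (step Δ p) s (fun b => ¬ Good (step Δ p) (threshold Δ X (r + 1)) b) ≤
      Real.exp (-X ^ n) := by
  have hk := h.three_le_k
  have hstep := hp.step (Δ := Δ) (by omega : 2 ≤ k)
  have h1 := h.prob_exists_bad_le hp hq s
  -- The concentration exponent is fixed, whence the restriction `n ≤ 3`.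
  have h2 := (h.prob_truncDev_le hp hs r s).trans (h.union_bound hn)
  refine le_trans ?_ ((add_le_add h1 h2).trans (le_of_eq (add_halves _)))
  refine le_trans (hstep.prob_le fun b hb hbad => ?_) (hstep.prob_or_le s _ _)
  by_contra hcon
  push Not at hcon
  exact hbad (h.good_step_succ hp (hstep.mass_ne_zero hb) hcon.1 fun c => (hcon.2 c).le)

/-- The deviation stays small even when a few children are exceptional. -/
lemma Scale.prob_step_robust (h : Scale Δ k X) (hp : IsChannel p) {n r : ℕ}
    (hq : ∀ s, prob p s (fun b => ¬ Good p (threshold Δ X r) b) ≤ Real.exp (-X ^ (n + 5)))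
    (hq' : ∀ s, prob p s (fun b => ¬ Good p (threshold Δ X (r + 2)) b) ≤
      Real.exp (-X ^ (n + 1))) (s : Fin k) :
    prob (step Δ p) s (fun b => ¬ Good (step Δ p) (threshold Δ X (r + 1)) b) ≤
      Real.exp (-X ^ (n + 4)) := by
  classical
  have hk := h.three_le_k
  have hX := h.X_pos
  have hstep := hp.step (Δ := Δ) (by omega : 2 ≤ k)
  have hXn : X ≤ X ^ (n + 1) := by simpa using h.pow_le_pow (show 1 ≤ n + 1 by omega)
  have h1 := h.prob_exists_bad_le hp hq s
  -- Demanding `X ^ 8` simultaneous failures raises the weak exponent `X ^ (n + 1)` to `X ^ (n + 9)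
  -- / 2`, which more than restores the power lost by asking for a threshold two steps ahead.
  have h2 : prob (step Δ p) s (fun b => X ^ 8 ≤ #{i | ¬ Good p (threshold Δ X (r + 2)) (b i)}) ≤
      Real.exp (-X ^ (n + 4)) / 2 := by
    refine ((hp.prob_step_card_le (by omega) (pow_pos hX (n + 1)).le hq' (h.Δ_mul_exp_le hXn) s
      (X ^ 8)).trans (le_of_eq (congrArg Real.exp
      (by ring : 1 - X ^ 8 * (X ^ (n + 1) / 2) = -(X ^ (n + 9) / 2 - 1))))).trans
      (exp_neg_le_half_exp_neg ?_)
    have h1 : 1000 * X ^ (n + 4) ≤ X ^ (n + 9) := h.mul_pow_le (by omega)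
    have h2 := h.one_le_pow (n + 4)
    linarith
  refine le_trans ?_ ((add_le_add h1 h2).trans (le_of_eq (add_halves _)))
  refine le_trans (hstep.prob_le fun b hb hbad => ?_) (hstep.prob_or_le s _ _)
  by_contra hcon
  push Not at hcon
  exact hbad (h.good_step_of_card_le (hstep.mass_ne_zero hb) hcon.1 hcon.2.le)

end Recursion

/-! ### The induction on depth -/

section TreeChannel

/-- The colourings of the leaves of the tree of depth `ℓ`, organised by subtrees. -/
def Boundary (Δ k : ℕ) : ℕ → Type
  | 0 => Fin k
  | ℓ + 1 => Fin Δ → Boundary Δ k ℓ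

noncomputable instance instFintypeBoundary (Δ k : ℕ) : ∀ ℓ, Fintype (Boundary Δ k ℓ)
  | 0 => inferInstanceAs (Fintype (Fin k))
  | ℓ + 1 =>
    haveI := instFintypeBoundary Δ k ℓ
    inferInstanceAs (Fintype (Fin Δ → Boundary Δ k ℓ))

/-- The law of the colours of the leaves given the colour of the root. -/
noncomputable def treeChannel (Δ k : ℕ) : ∀ ℓ, Fin k → Boundary Δ k ℓ → ℝ
  | 0 => leafChannel k
  | ℓ + 1 => step Δ (treeChannel Δ k ℓ)

variable {Δ k : ℕ} {X : ℝ}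

lemma isChannel_treeChannel (hk : 2 ≤ k) : ∀ ℓ, IsChannel (treeChannel Δ k ℓ)
  | 0 => isChannel_leafChannel
  | ℓ + 1 => (isChannel_treeChannel hk ℓ).step hk

lemma isColorSymmetric_treeChannel : ∀ ℓ, IsColorSymmetric (treeChannel Δ k ℓ)
  | 0 => isColorSymmetric_leafChannel
  | ℓ + 1 => (isColorSymmetric_treeChannel ℓ).step

/-- The posterior of the root given the leaves is doubly exponentially likely to be close to
uniform. -/
theorem Scale.prob_treeChannel_le (h : Scale Δ k X) {ℓ : ℕ} (hℓ : 1 ≤ ℓ) :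
    ∀ r u, ℓ = 2 * r + u → ∀ s, prob (treeChannel Δ k ℓ) s
      (fun b => ¬ Good (treeChannel Δ k ℓ) (threshold Δ X r) b) ≤ Real.exp (-X ^ u) := by
  have hk : 2 ≤ k := by linarith [h.three_le_k]
  induction ℓ, hℓ using Nat.le_induction with
  | base =>
    intro r u hru s
    obtain rfl : r = 0 := by omega
    obtain rfl : u = 1 := by omega
    rw [pow_one]
    exact h.prob_leaf_step s
  | succ ℓ hℓ ih =>
    intro r u hru s
    have hp := isChannel_treeChannel (Δ := Δ) hk ℓ
    -- In every case the invariant `ℓ = 2 * r + u` fixes the exponents available for the children: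
    -- `u + 1` at threshold `r`, and in the robust case `u = v + 4` also `v + 1` at threshold `r +
    -- 2`.
    rcases r with _ | r
    · obtain rfl : u = ℓ + 1 := by omega
      exact h.prob_step_zero hp hℓ (ih 0 ℓ (by omega)) s
    · rcases le_or_gt u 3 with hu | hu
      · exact h.prob_step_contract hp (isColorSymmetric_treeChannel ℓ) hu
          (ih r (u + 1) (by omega)) s
      · obtain ⟨v, rfl⟩ := Nat.exists_eq_add_of_le' hu
        exact h.prob_step_robust hp (n := v) (ih r (v + 5) (by omega))
          (ih (r + 2) (v + 1) (by omega)) s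

end TreeChannel

end TreeColoring

namespace TreeColoring

open Finset

/-! ### From uniform colourings to the channel -/

section Bridge

variable {Δ k ℓ : ℕ}

/-- The child of the root with index `i`, followed by the path `v`. -/
def consVertex (i : Fin Δ) (v : Vertex Δ ℓ) : Vertex Δ (ℓ + 1) :=
  ⟨i :: v.1, Nat.succ_le_succ v.2⟩

lemma isChild_consVertex (i : Fin Δ) {v w : Vertex Δ ℓ} (h : IsChild v w) :
    IsChild (consVertex i v) (consVertex i w) := by
  obtain ⟨j, hj⟩ := h
  exact ⟨j, by simp [consVertex, hj]⟩

lemma isChild_root_consVertex (i : Fin Δ) :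
    IsChild (root Δ (ℓ + 1)) (consVertex i (root Δ ℓ)) := ⟨i, by simp [consVertex, root]⟩

/-- The restriction of a colouring to the subtree of the `i`-th child of the root. -/
def restrict (σ : Colorings Δ k (ℓ + 1)) (i : Fin Δ) : Colorings Δ k ℓ :=
  SimpleGraph.Coloring.mk (fun v => σ (consVertex i v)) fun {v w} h => by
    refine σ.valid ?_
    rcases h with h | h
    · exact Or.inl (isChild_consVertex i h)
    · exact Or.inr (isChild_consVertex i h)

lemma restrict_root_ne (σ : Colorings Δ k (ℓ + 1)) (i : Fin Δ) :
    restrict σ i (root Δ ℓ) ≠ σ (root Δ (ℓ + 1)) :=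
  (σ.valid (Or.inl (isChild_root_consVertex i))).symm

/-- The colours of a colouring obtained from the root colour and colourings of the subtrees. -/
def glueFun (s : Fin k) (τ : Fin Δ → Colorings Δ k ℓ) : Vertex Δ (ℓ + 1) → Fin k
  | ⟨[], _⟩ => s
  | ⟨i :: l, h⟩ => τ i ⟨l, Nat.le_of_succ_le_succ h⟩

lemma glueFun_ne {s : Fin k} {τ : Fin Δ → Colorings Δ k ℓ} (hs : ∀ i, τ i (root Δ ℓ) ≠ s)
    {v w : Vertex Δ (ℓ + 1)} (h : IsChild v w) : glueFun s τ v ≠ glueFun s τ w := by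
  obtain ⟨j, hj⟩ := h
  obtain ⟨v, hv⟩ := v
  obtain ⟨w, hw⟩ := w
  dsimp only at hj
  subst hj
  rcases v with _ | ⟨i, l⟩
  · exact (hs j).symm
  · exact (τ i).valid (v := ⟨l, _⟩) (w := ⟨l ++ [j], _⟩) (Or.inl ⟨j, rfl⟩)

/-- A colouring is glued from the colour of the root and colourings of the subtrees. -/
def glue (s : Fin k) (τ : Fin Δ → Colorings Δ k ℓ) (hs : ∀ i, τ i (root Δ ℓ) ≠ s) :
    Colorings Δ k (ℓ + 1) :=
  SimpleGraph.Coloring.mk (glueFun s τ) fun {v w} h => by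
    rcases h with h | h
    · exact glueFun_ne hs h
    · exact (glueFun_ne hs h).symm

lemma coloring_ext {σ τ : Colorings Δ k (ℓ + 1)} (h : σ (root Δ (ℓ + 1)) = τ (root Δ (ℓ + 1)))
    (h' : ∀ i, restrict σ i = restrict τ i) : σ = τ := by
  refine DFunLike.ext _ _ fun v => ?_
  obtain ⟨v, hv⟩ := v
  rcases v with _ | ⟨i, l⟩
  · exact h
  · exact DFunLike.congr_fun (h' i) ⟨l, Nat.le_of_succ_le_succ hv⟩

/-- The colours of the leaves. -/
def leafColors : ∀ {ℓ : ℕ}, Colorings Δ k ℓ → Boundary Δ k ℓ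
  | 0, σ => σ (root Δ 0)
  | _ + 1, σ => fun i => leafColors (restrict σ i)

lemma leafColors_eq_iff {σ τ : Colorings Δ k ℓ} :
    leafColors σ = leafColors τ ↔ ∀ v ∈ leaves Δ ℓ, σ v = τ v := by
  induction ℓ with
  | zero =>
    constructor
    · rintro h ⟨v, hv⟩ -
      obtain rfl : v = [] := List.length_eq_zero_iff.1 (Nat.le_zero.1 hv)
      exact h
    · intro h
      exact h (root Δ 0) rfl
  | succ ℓ ih =>
    constructor
    · rintro h ⟨v, hv⟩ hvl
      rcases v with _ | ⟨i, l⟩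
      · exact absurd hvl (by simp [leaves])
      · exact ih.1 (congrFun h i) ⟨l, Nat.le_of_succ_le_succ hv⟩ (Nat.succ_injective hvl)
    · intro h
      funext i
      exact ih.2 fun v hv => h (consVertex i v) (congrArg Nat.succ hv)

/-- The number of colourings with given colours of the root and of the leaves. -/
noncomputable def colorCount (ℓ : ℕ) (s : Fin k) (b : Boundary Δ k ℓ) : ℕ :=
  Nat.card {σ : Colorings Δ k ℓ // σ (root Δ ℓ) = s ∧ leafColors σ = b}

/-- Colourings of the tree correspond to families of colourings of the subtrees. -/
def coloringEquiv (s : Fin k) (b : Boundary Δ k (ℓ + 1)) :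
    {σ : Colorings Δ k (ℓ + 1) // σ (root Δ (ℓ + 1)) = s ∧ leafColors σ = b} ≃
      ∀ i : Fin Δ, {σ : Colorings Δ k ℓ // σ (root Δ ℓ) ≠ s ∧ leafColors σ = b i} where
  toFun σ i := ⟨restrict σ.1 i, fun h => restrict_root_ne σ.1 i (h.trans σ.2.1.symm),
    congrFun σ.2.2 i⟩
  invFun τ := ⟨glue s (fun i => (τ i).1) fun i => (τ i).2.1, rfl, funext fun i => (τ i).2.2⟩
  left_inv σ := Subtype.ext (coloring_ext σ.2.1.symm fun _ => rfl)
  right_inv _ := rfl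

noncomputable instance : Fintype (Colorings Δ k ℓ) := Fintype.ofFinite _

lemma colorCount_eq_card (s : Fin k) (b : Boundary Δ k ℓ)
    [DecidablePred fun σ : Colorings Δ k ℓ => σ (root Δ ℓ) = s ∧ leafColors σ = b] :
    colorCount ℓ s b = #{σ : Colorings Δ k ℓ | σ (root Δ ℓ) = s ∧ leafColors σ = b} := by
  unfold colorCount
  rw [Nat.card_eq_fintype_card, Fintype.card_subtype]

lemma card_filter_leafColors (P : Fin k → Boundary Δ k ℓ → Prop) [∀ s b, Decidable (P s b)]
    [DecidablePred fun σ : Colorings Δ k ℓ => P (σ (root Δ ℓ)) (leafColors σ)] :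
    #{σ : Colorings Δ k ℓ | P (σ (root Δ ℓ)) (leafColors σ)} =
      ∑ s, ∑ b, if P s b then colorCount ℓ s b else 0 := by
  classical
  rw [← sum_product', univ_product_univ, card_eq_sum_card_fiberwise
    (f := fun σ : Colorings Δ k ℓ => (σ (root Δ ℓ), leafColors σ)) (t := univ) (by simp)]
  refine sum_congr rfl fun x _ => ?_
  rw [colorCount_eq_card, filter_filter]
  split_ifs with h
  · congr 1
    ext σ
    simp only [mem_filter, mem_univ, true_and, Prod.ext_iff]
    constructor
    · exact fun h' => h'.2
    · rintro ⟨h1, h2⟩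
      refine ⟨?_, h1, h2⟩
      rwa [h1, h2]
  · rw [card_eq_zero, filter_eq_empty_iff]
    rintro σ - ⟨h1, rfl⟩
    exact h h1

lemma card_root_ne (s : Fin k) (b : Boundary Δ k ℓ) :
    Nat.card {σ : Colorings Δ k ℓ // σ (root Δ ℓ) ≠ s ∧ leafColors σ = b} =
      ∑ j ∈ univ.erase s, colorCount ℓ j b := by
  classical
  rw [Nat.card_eq_fintype_card, Fintype.card_subtype,
    card_filter_leafColors fun j b' => j ≠ s ∧ b' = b, ← filter_ne', sum_filter]
  simp [ite_and]

lemma colorCount_succ (s : Fin k) (b : Boundary Δ k (ℓ + 1)) :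
    colorCount (ℓ + 1) s b = ∏ i : Fin Δ, ∑ j ∈ univ.erase s, colorCount ℓ j (b i) := by
  unfold colorCount
  rw [Nat.card_congr (coloringEquiv s b), Nat.card_pi]
  refine prod_congr rfl fun i _ => ?_
  exact card_root_ne s (b i)

/-- Counts and channel satisfy the same product recursion, except that each child law is divided by
`k - 1`. The constant depends on neither the root colour nor the boundary, so it cancels in every
conditional probability. -/
lemma exists_colorCount_eq (hk : 2 ≤ k) (ℓ : ℕ) : ∃ n : ℝ, 0 < n ∧
    ∀ (s : Fin k) (b : Boundary Δ k ℓ), (colorCount ℓ s b : ℝ) = n * treeChannel Δ k ℓ s b := by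
  have hk' : (2 : ℝ) ≤ k := by exact_mod_cast hk
  induction ℓ with
  | zero =>
    refine ⟨1, one_pos, fun s b => ?_⟩
    have huniq : ∀ σ τ : Colorings Δ k 0, σ (root Δ 0) = τ (root Δ 0) → σ = τ := by
      intro σ τ h
      refine DFunLike.ext _ _ fun v => ?_
      obtain ⟨v, hv⟩ := v
      obtain rfl : v = [] := List.length_eq_zero_iff.1 (Nat.le_zero.1 hv)
      exact h
    rw [one_mul]
    unfold treeChannel leafChannel colorCount
    split_ifs with h
    · rw [Nat.cast_eq_one, Nat.card_eq_one_iff_unique]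
      refine ⟨⟨fun σ τ => Subtype.ext (huniq _ _ (σ.2.1.trans τ.2.1.symm))⟩,
        ⟨⟨SimpleGraph.Coloring.mk (fun _ => s) fun {v w} hvw => ?_, rfl, h.symm⟩⟩⟩
      have h0 : ∀ v : Vertex Δ 0, v = root Δ 0 := fun v =>
        Subtype.ext (List.length_eq_zero_iff.1 (Nat.le_zero.1 v.2))
      rw [h0 v, h0 w] at hvw
      exact absurd hvw (SimpleGraph.irrefl _)
    · have : IsEmpty {σ : Colorings Δ k 0 // σ (root Δ 0) = s ∧ leafColors σ = b} :=
        ⟨fun σ => h (σ.2.2.symm.trans σ.2.1)⟩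
      rw [Nat.card_of_isEmpty, Nat.cast_zero]
  | succ ℓ ih =>
    obtain ⟨n, hn, hcount⟩ := ih
    refine ⟨(n * ((k : ℝ) - 1)) ^ Δ, pow_pos (mul_pos hn (by linarith)) _, fun s b => ?_⟩
    have hpow : (n * ((k : ℝ) - 1)) ^ Δ = ∏ _i : Fin Δ, (n * ((k : ℝ) - 1)) := by
      rw [prod_const, card_univ, Fintype.card_fin]
    rw [colorCount_succ, hpow]
    unfold treeChannel step
    rw [← prod_mul_distrib]
    push_cast
    refine prod_congr rfl fun i _ => ?_
    simp_rw [hcount]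
    rw [← mul_sum, childLik, mul_assoc, mul_div_cancel₀ _ (by linarith : (k : ℝ) - 1 ≠ 0)]

open Classical in
lemma mu_real_eq (S : Set (Colorings Δ k ℓ)) :
    (mu Δ k ℓ).real S = #{σ | σ ∈ S} / Fintype.card (Colorings Δ k ℓ) := by
  have hS : S = (({σ | σ ∈ S} : Finset (Colorings Δ k ℓ)) : Set (Colorings Δ k ℓ)) := by
    ext σ
    simp
  conv_lhs => rw [hS]
  rw [measureReal_def, mu, uniformOn_univ, ENNReal.toReal_div, ENNReal.toReal_natCast,
    Measure.count_apply_finset, ENNReal.toReal_natCast]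

lemma mu_real_mono {P Q : Colorings Δ k ℓ → Prop} (h : ∀ τ, P τ → Q τ) :
    (mu Δ k ℓ).real {τ | P τ} ≤ (mu Δ k ℓ).real {τ | Q τ} := by
  classical
  rw [mu_real_eq, mu_real_eq]
  gcongr with τ
  exact h τ

lemma rootMarginal_eq (hk : 2 ≤ k) (τ : Colorings Δ k ℓ) (c : Fin k) :
    rootMarginal τ c = post (treeChannel Δ k ℓ) (leafColors τ) c := by
  classical
  obtain ⟨n, hn, hcount⟩ := exists_colorCount_eq (Δ := Δ) hk ℓ
  have hN : (0 : ℝ) < Fintype.card (Colorings Δ k ℓ) := by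
    exact_mod_cast Fintype.card_pos_iff.2 ⟨τ⟩
  have hleaf : (leafEvent τ : Set (Colorings Δ k ℓ)) = {σ | leafColors σ = leafColors τ} := by
    ext σ
    exact leafColors_eq_iff.symm
  have h1 : (mu Δ k ℓ).real (leafEvent τ) =
      n * mass (treeChannel Δ k ℓ) (leafColors τ) / Fintype.card (Colorings Δ k ℓ) := by
    rw [mu_real_eq, hleaf]
    simp only [Set.mem_ofPred_eq]
    rw [card_filter_leafColors fun _ b => b = leafColors τ]
    simp [hcount, mass, mul_sum]
  have h2 : (mu Δ k ℓ).real (leafEvent τ ∩ rootEvent c) =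
      n * treeChannel Δ k ℓ c (leafColors τ) / Fintype.card (Colorings Δ k ℓ) := by
    rw [mu_real_eq, hleaf]
    simp only [Set.mem_inter_iff, Set.mem_ofPred_eq, rootEvent]
    rw [card_filter_leafColors fun s b => b = leafColors τ ∧ s = c]
    simp [hcount, ite_and]
  rw [rootMarginal, measureReal_def, cond_apply (Set.toFinite _).measurableSet, ENNReal.toReal_mul,
    ENNReal.toReal_inv, ← measureReal_def, ← measureReal_def, h1, h2, post]
  field_simp

/-- Every root colour has the same number of colourings, so the uniform measure is the average of
the channel over root colours. -/
lemma mu_real_leafColors_le (hk : 2 ≤ k) (P : Boundary Δ k ℓ → Prop) {q : ℝ}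
    (hP : ∀ s, prob (treeChannel Δ k ℓ) s P ≤ q) :
    (mu Δ k ℓ).real {τ | P (leafColors τ)} ≤ q := by
  classical
  obtain ⟨n, hn, hcount⟩ := exists_colorCount_eq (Δ := Δ) hk ℓ
  have hk0 : (0 : ℝ) < k := by
    have : 0 < k := by omega
    exact_mod_cast this
  have h1 : (#{σ : Colorings Δ k ℓ | P (leafColors σ)} : ℝ) =
      n * ∑ s, prob (treeChannel Δ k ℓ) s P := by
    rw [card_filter_leafColors fun _ b => P b]
    push_cast
    simp_rw [prob_eq_sum_ite, mul_sum, hcount, mul_ite, mul_zero]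
  have h2 : (Fintype.card (Colorings Δ k ℓ) : ℝ) = n * k := by
    have := card_filter_leafColors (Δ := Δ) (k := k) (ℓ := ℓ) fun _ _ => True
    simp only [filter_true, card_univ, if_true] at this
    rw [this]
    push_cast
    simp_rw [hcount, ← mul_sum, (isChannel_treeChannel hk ℓ).sum_eq_one]
    simp
  rw [mu_real_eq]
  simp only [Set.mem_ofPred_eq]
  rw [h1, h2, mul_div_mul_left _ _ hn.ne', div_le_iff₀ hk0]
  calc ∑ s, prob (treeChannel Δ k ℓ) s P ≤ ∑ _s : Fin k, q := sum_le_sum fun s _ => hP s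
    _ = _ := by
        rw [sum_const, card_univ, Fintype.card_fin, nsmul_eq_mul, mul_comm]

end Bridge

end TreeColoring

namespace TreeColoring

open Filter

/-! ### Choice of scale and exponents -/

section Asymptotics

lemma exists_scale {ε : ℝ} (hε : 0 < ε) (hε' : ε ≤ 1 / 3) :
    ∃ N : ℕ, ∀ Δ k : ℕ, N < Δ → (1 + ε) * (Δ : ℝ) / Real.log Δ < k →
      Scale Δ k ((Δ : ℝ) ^ (ε / 64)) := by
  have h1 : Tendsto (fun x : ℝ => x ^ (ε / 64)) atTop atTop := tendsto_rpow_atTop (by positivity)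
  have h2 : ∀ᶠ x : ℝ in atTop, 4 * Real.log x ≤ x ^ (ε / 64) := by
    have h3 := (isLittleO_log_rpow_atTop (show 0 < ε / 64 by positivity)).bound
      (show (0 : ℝ) < 1 / 4 by norm_num)
    filter_upwards [h3, eventually_ge_atTop 1] with x hx hx1
    rw [Real.norm_of_nonneg (Real.log_nonneg hx1), Real.norm_of_nonneg (by positivity)] at hx
    linarith
  obtain ⟨N, hN⟩ := eventually_atTop.1 (tendsto_natCast_atTop_atTop.eventually
    (((h1.eventually_ge_atTop (1000 : ℝ)).and (h1.eventually_ge_atTop (2 / ε))).and h2))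
  refine ⟨max N 3, fun Δ k hΔ hk => ?_⟩
  obtain ⟨⟨hX1, hX2⟩, hlog⟩ := hN Δ ((le_max_left _ _).trans hΔ.le)
  have hΔ0 : (0 : ℝ) < Δ := by
    have : 0 < Δ := by omega
    exact_mod_cast this
  have hΔ1 : (1 : ℝ) ≤ Δ := by
    have : 1 ≤ Δ := by omega
    exact_mod_cast this
  have hL : 0 < Real.log Δ := Real.log_pos (by exact_mod_cast (by omega : 1 < Δ))
  have hk0 : (0 : ℝ) < k := lt_of_le_of_lt (by positivity) hk
  have hX0 : (0 : ℝ) < (Δ : ℝ) ^ (ε / 64) := by positivity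
  refine ⟨hX1, hlog, ?_, by exact_mod_cast hk0, ?_⟩
  · rw [← Real.rpow_natCast, ← Real.rpow_mul hΔ0.le]
    calc (Δ : ℝ) ^ (ε / 64 * (64 : ℕ)) ≤ (Δ : ℝ) ^ (1 : ℝ) :=
          Real.rpow_le_rpow_of_exponent_le hΔ1 (by push_cast; linarith)
      _ = Δ := Real.rpow_one _
  · rw [Real.log_rpow hΔ0]
    have h3 : 1 / (Δ : ℝ) ^ (ε / 64) ≤ ε / 2 := by
      rw [div_le_iff₀ hX0]
      rw [div_le_iff₀ hε] at hX2
      linarith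
    have h4 : (1 + ε) * (Δ / k) ≤ Real.log Δ := by
      rw [div_lt_iff₀ hL] at hk
      rw [← mul_div_assoc, div_le_iff₀ hk0]
      linarith
    calc (1 + 1 / (Δ : ℝ) ^ (ε / 64)) * (Δ / k) ≤ (1 + ε / 2) * (Δ / k) := by gcongr
      -- Here `24 * log X = (3 * ε / 8) * log Δ`, and `1 + ε / 2 ≤ (1 - 3 * ε / 8) * (1 + ε)` holds
      -- for positive `ε` exactly when `ε ≤ 1 / 3`.
      _ ≤ (1 - 3 * ε / 8) * ((1 + ε) * (Δ / k)) := by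
          rw [← mul_assoc]
          gcongr
          nlinarith
      _ ≤ (1 - 3 * ε / 8) * Real.log Δ := by
          gcongr
          linarith
      _ = _ := by ring

variable {Δ k : ℕ}

lemma Scale.mu_real_rootMarginal_le {X : ℝ} (h : Scale Δ k X) (c : Fin k) {ℓ r u : ℕ}
    (hr : 1 ≤ r) (hℓ : ℓ = 2 * r + u) :
    (mu Δ k ℓ).real {τ | |rootMarginal τ c - 1 / (k : ℝ)| > (X ^ (2 * r))⁻¹} ≤
      Real.exp (-X ^ u) := by
  have hk : 2 ≤ k := by linarith [h.three_le_k]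
  have hk0 := h.k_cast_pos
  have hk1 := h.k_large
  refine le_trans (mu_real_mono (fun τ hτ => ?_)) (mu_real_leafColors_le hk
    (fun b => ¬ Good (treeChannel Δ k ℓ) (threshold Δ X r) b)
    (h.prob_treeChannel_le (by omega) r u hℓ))
  intro hgood
  refine absurd hτ (not_lt.2 ?_)
  obtain ⟨r, rfl⟩ := Nat.exists_eq_add_of_le' hr
  rw [rootMarginal_eq hk]
  have h2 := hgood.2 c
  simp only [threshold] at h2
  have h3 : (k : ℝ) * |post (treeChannel Δ k ℓ) (leafColors τ) c - 1 / k| ≤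
      (X ^ (2 * (r + 1)))⁻¹ := by
    rw [← abs_of_pos hk0, ← abs_mul, abs_of_pos hk0, mul_sub, mul_one_div_cancel hk0.ne']
    exact h2
  refine le_trans ?_ h3
  -- The relative bound is stronger than the absolute one by a factor `k`, which is discarded.
  exact le_mul_of_one_le_left (abs_nonneg _) (by linarith)

lemma Scale.mu_real_rpow_le {ε : ℝ} (hε : 0 < ε) (h : Scale Δ k ((Δ : ℝ) ^ (ε / 64)))
    (c : Fin k) {ℓ : ℕ} (hℓ : 3 < ℓ) :
    (mu Δ k ℓ).real
      {τ | |rootMarginal τ c - 1 / (k : ℝ)| > (Δ : ℝ) ^ (-(ε / 256 * (ℓ : ℝ)))} ≤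
      Real.exp (-((Δ : ℝ) ^ (ε / 128 * (ℓ : ℝ)))) := by
  have hΔ0 := h.Δ_pos
  have hΔ1 : (1 : ℝ) ≤ Δ := (h.one_le_pow 64).trans h.pow_le
  have hpow : ∀ n : ℕ, ((Δ : ℝ) ^ (ε / 64)) ^ n = (Δ : ℝ) ^ (ε / 64 * n) := fun n => by
    rw [← Real.rpow_natCast, ← Real.rpow_mul hΔ0.le]
  -- The condition `ℓ ≥ 4` makes the floor `ℓ / 4` positive and gives `ℓ ≤ 8 * (ℓ / 4)`, whence `ε /
  -- 256`; the remainder `u` is at least `ℓ / 2`, whence `ε / 128`.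
  have h1 := h.mu_real_rootMarginal_le c (ℓ := ℓ) (r := ℓ / 4) (u := ℓ - 2 * (ℓ / 4))
    (by omega) (by omega)
  refine le_trans (mu_real_mono (fun τ hτ => lt_of_le_of_lt ?_ hτ)) (h1.trans ?_)
  · rw [hpow, Real.rpow_neg hΔ0.le]
    refine inv_anti₀ (by positivity) (Real.rpow_le_rpow_of_exponent_le hΔ1 ?_)
    have h2 : (ℓ : ℝ) ≤ 8 * (ℓ / 4 : ℕ) := by exact_mod_cast (by omega : ℓ ≤ 8 * (ℓ / 4))
    push_cast at *
    nlinarith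
  · rw [hpow, Real.exp_le_exp, neg_le_neg_iff]
    refine Real.rpow_le_rpow_of_exponent_le hΔ1 ?_
    have h2 : (ℓ : ℝ) ≤ 2 * (ℓ - 2 * (ℓ / 4) : ℕ) := by
      exact_mod_cast (by omega : ℓ ≤ 2 * (ℓ - 2 * (ℓ / 4)))
    nlinarith

end Asymptotics

end TreeColoring

theorem theorem2 :
    ∃ (α α' : ℝ → ℝ) (Δ₀ ℓ₀ : ℝ → ℕ),
      ∀ (C ε : ℝ), 1 < C → ε = min (C - 1) (1 / 3) →
        0 < α ε ∧ 0 < α' ε ∧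
        ∀ Δ : ℕ, Δ₀ ε < Δ →
        ∀ k : ℕ, C * (Δ : ℝ) / Real.log (Δ : ℝ) < (k : ℝ) →
        ∀ c : Fin k, ∀ ℓ : ℕ, ℓ₀ ε < ℓ →
          (TreeColoring.mu Δ k ℓ).real
              {τ | |TreeColoring.rootMarginal τ c - 1 / (k : ℝ)| > (Δ : ℝ) ^ (-(α ε * (ℓ : ℝ)))}
            ≤ Real.exp (-((Δ : ℝ) ^ (α' ε * (ℓ : ℝ)))) := by
  -- Stated for every real `ε`, with the default 0 outside the range, so that the threshold on `Δ`
  -- can be chosen as a function of `ε` alone. The constant `C` enters only through `1 + ε ≤ C`.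
  have hN : ∀ ε : ℝ, ∃ N : ℕ, 0 < ε → ε ≤ 1 / 3 → ∀ Δ k : ℕ, N < Δ →
      (1 + ε) * (Δ : ℝ) / Real.log Δ < k → TreeColoring.Scale Δ k ((Δ : ℝ) ^ (ε / 64)) := by
    intro ε
    by_cases h : 0 < ε ∧ ε ≤ 1 / 3
    · obtain ⟨N, hN⟩ := TreeColoring.exists_scale h.1 h.2
      exact ⟨N, fun _ _ => hN⟩
    · exact ⟨0, fun h1 h2 => absurd ⟨h1, h2⟩ h⟩
  choose N hN using hN
  refine ⟨fun ε => ε / 256, fun ε => ε / 128, N, fun _ => 3, fun C ε hC hε => ?_⟩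
  have hε0 : 0 < ε := by
    rw [hε]
    exact lt_min (by linarith) (by norm_num)
  have hε1 : ε ≤ 1 / 3 := hε ▸ min_le_right _ _
  have hεC : ε ≤ C - 1 := hε ▸ min_le_left _ _
  refine ⟨by positivity, by positivity, fun Δ hΔ k hk c ℓ hℓ => ?_⟩
  refine TreeColoring.Scale.mu_real_rpow_le hε0 (hN ε hε0 hε1 Δ k hΔ (lt_of_le_of_lt ?_ hk)) c hℓ
  gcongr
  linarith
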